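/- Let $q_0>0$ and $q_\pm\in\mathbb C$ with $|q_\pm|=q_0$. Let $q(x,t)$, $(x,t)\in\mathbb R^2$, be a classical solution ($q,q_x,q_{xx},q_t$ exist and are continuous on $\mathbb R^2$) of the focusing nonlinear Schrödinger equation $iq_t+\tfrac12 q_{xx}+(|q|^2-q_0^2)q=0$ such that $q\to q_\pm$ and $q_x\to 0$ as $x\to\pm\infty$, locally uniformly in $t$, and assume that $q(\cdot,t)-q_-\in L^1(\mathbb R^-)$ and $q(\cdot,t)-q_+\in L^1(\mathbb R^+)$ for every $t$. For $z\in\mathbb C\setminus\{0\}$ put $k=\tfrac12(z-q_0^2/z)$, $\lambda=\tfrac12(z+q_0^2/z)$, $\theta=\lambda(x+kt)$, $\gamma(z)=1+q_0^2/z^2$, and let $D^\pm=\{z:\pm(|z|^2-q_0^2)\,\mathrm{Im}\,z>0\}$, $\Sigma=\{z\ne0: z\in\mathbb R\text{ or }|z|=q_0\}$, $\Sigma_0=\Sigma\setminus\{\pm iq_0\}$. With $\sigma_3=\mathrm{diag}(1,-1)$ and $Q=\begin{pmatrix}0&q\\-q^*&0\end{pmatrix}$, $Q_\pm=\begin{pmatrix}0&q_\pm\\-q_\pm^*&0\end{pmatrix}$,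 consider the Lax pair $\psi_x=X\psi$, $\psi_t=T\psi$, $$X=-ik\sigma_3+Q,\qquad T=-ik^2\sigma_3+kQ+\tfrac i2\sigma_3Q_x-\tfrac i2(Q^2+q_0^2 I)\sigma_3 ,$$ and let $Y_\pm=I-(i/z)\sigma_3Q_\pm$. The Jost solutions $\psi_\pm(x,t;z)$ are the $2\times 2$ matrix solutions of the Lax pair with $\psi_\pm e^{i\theta\sigma_3}\to Y_\pm$ as $x\to\pm\infty$ for every $t$; $\psi_{\pm,j}$ denotes the $j$-th column, which is determined by the corresponding column of these conditions. Then the columns $\psi_{-,1},\psi_{+,2}$ exist and are unique for every $z\in D^+\cup\Sigma_0$, the columns $\psi_{+,1},\psi_{-,2}$ exist and are unique for every $z\in D^-\cup\Sigma_0$, $\gamma\neq0$ on $D^+\cup D^-\cup\Sigma_0$, and $\det\psi_\pm=\gamma(z)$ for $z\in\Sigma_0$. For every $z\in\Sigma_0$ there is a unique matrix $S(z)=(s_{ij}(z))$, independent of $x$ and $t$, with $$\psi_+(x,t;z)=\psi_-(x,t;z)S(z)\quad\text{for all }x,t,$$ and $\det S(z)=1$. With $\mathrm{Wr}(v,w)=\det(v,w)$,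 its entries are, for all $x,t$, $$s_{11}=\frac{\mathrm{Wr}(\psi_{+,1},\psi_{-,2})}{\gamma},\quad s_{22}=\frac{\mathrm{Wr}(\psi_{-,1},\psi_{+,2})}{\gamma},\quad s_{12}=\frac{\mathrm{Wr}(\psi_{+,2},\psi_{-,2})}{\gamma},\quad s_{21}=\frac{\mathrm{Wr}(\psi_{-,1},\psi_{+,1})}{\gamma}.$$ The formula for $s_{11}$ defines it, independently of $x,t$, on $D^-\cup\Sigma_0$, and there it is continuous, and analytic in $D^-$; the formula for $s_{22}$ defines it, independently of $x,t$, on $D^+\cup\Sigma_0$, and there it is continuous, and analytic in $D^+$. The off-diagonal entries $s_{12},s_{21}$ are defined and continuous on $\Sigma_0$. -/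

import Mathlib

open Filter Topology MeasureTheory Matrix

noncomputable section

namespace NZBC

/-- The functions of the uniformization variable `z`, for `z ≠ 0`:
`k = (z - q₀² / z) / 2`. -/
def kz (q₀ : ℝ) (z : ℂ) : ℂ := (z - (q₀ : ℂ) ^ 2 / z) / 2

/-- `λ = (z + q₀² / z) / 2`. -/
def lam (q₀ : ℝ) (z : ℂ) : ℂ := (z + (q₀ : ℂ) ^ 2 / z) / 2

/-- `γ = 1 + q₀² / z²`. -/
def gam (q₀ : ℝ) (z : ℂ) : ℂ := 1 + (q₀ : ℂ) ^ 2 / z ^ 2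

/-- `θ(x,t;z) = λ (x + k t)`. -/
def theta (q₀ : ℝ) (x t : ℝ) (z : ℂ) : ℂ := lam q₀ z * ((x : ℂ) + kz q₀ z * (t : ℂ))

/-- The domain `D⁺` (where `Im λ > 0`). -/
def Dplus (q₀ : ℝ) : Set ℂ := {z | 0 < (‖z‖ ^ 2 - q₀ ^ 2) * z.im}

/-- The domain `D⁻` (where `Im λ < 0`). -/
def Dminus (q₀ : ℝ) : Set ℂ := {z | (‖z‖ ^ 2 - q₀ ^ 2) * z.im < 0}

/-- The continuous spectrum `Σ` (where `Im λ = 0`): the real axis and the circle of radius `q₀`.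
The point `z = 0`, where `k`, `λ` and `γ` are not defined, is left out. -/
def Sig (q₀ : ℝ) : Set ℂ := {z | z ≠ 0 ∧ (z.im = 0 ∨ ‖z‖ = q₀)}

/-- `Σ₀`, which is `Σ` without the branch points `± i q₀`. -/
def Sig0 (q₀ : ℝ) : Set ℂ := Sig q₀ \ {Complex.I * (q₀ : ℂ), -(Complex.I * (q₀ : ℂ))}

/-- The Pauli matrix `σ₃`. -/
def sigma3 : Matrix (Fin 2) (Fin 2) ℂ := !![1, 0; 0, -1]

/-- The matrix `Q` built from a value `w` of the potential. -/
def Qmat (w : ℂ) : Matrix (Fin 2) (Fin 2) ℂ := !![0, w; -(starRingEnd ℂ w), 0]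

/-- `X = -i k σ₃ + Q`, where `w` is the value of `q`. -/
def laxX (q₀ : ℝ) (z w : ℂ) : Matrix (Fin 2) (Fin 2) ℂ :=
  -(Complex.I * kz q₀ z) • sigma3 + Qmat w

/-- `T = -i k² σ₃ + k Q + (i/2) σ₃ Qₓ - (i/2) (Q² + q₀² I) σ₃`,
where `w` is the value of `q` and `wx` the value of `qₓ`. -/
def laxT (q₀ : ℝ) (z w wx : ℂ) : Matrix (Fin 2) (Fin 2) ℂ :=
  -(Complex.I * kz q₀ z ^ 2) • sigma3 + kz q₀ z • Qmat w
    + (Complex.I / 2) • (sigma3 * Qmat wx)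
    - (Complex.I / 2) • ((Qmat w * Qmat w + ((q₀ : ℂ) ^ 2) • (1 : Matrix (Fin 2) (Fin 2) ℂ)) * sigma3)

/-- The matrix `Y = I - (i/z) σ₃ Q` of asymptotic eigenvectors, for the boundary value `b`. -/
def Ymat (z b : ℂ) : Matrix (Fin 2) (Fin 2) ℂ := 1 - (Complex.I / z) • (sigma3 * Qmat b)

/-- The partial derivative `qₓ`. -/
def dx (q : ℝ → ℝ → ℂ) (x t : ℝ) : ℂ := deriv (fun y => q y t) x

/-- The partial derivative `q_t`. -/
def dt (q : ℝ → ℝ → ℂ) (x t : ℝ) : ℂ := deriv (fun s => q x s) t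

/-- Classical solutions of the focusing nonlinear Schrödinger equation
`i q_t + qₓₓ / 2 + (|q|² - q₀²) q = 0` on the plane. -/
structure IsClassicalSolution (q₀ : ℝ) (q : ℝ → ℝ → ℂ) : Prop where
  contDiff_x : ∀ t, ContDiff ℝ 2 (fun x => q x t)
  differentiable_t : ∀ x, Differentiable ℝ (fun t => q x t)
  continuous_q : Continuous (fun p : ℝ × ℝ => q p.1 p.2)
  continuous_dx : Continuous (fun p : ℝ × ℝ => dx q p.1 p.2)
  continuous_dxx : Continuous (fun p : ℝ × ℝ => dx (dx q) p.1 p.2)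
  equation : ∀ x t, Complex.I * dt q x t + dx (dx q) x t / 2
    + (((‖q x t‖ ^ 2 - q₀ ^ 2 : ℝ)) : ℂ) * q x t = 0

/-- `q → b` and `qₓ → 0` at one end `l` of the `x`-axis, locally uniformly in `t`. -/
structure HasBoundaryValue (q : ℝ → ℝ → ℂ) (b : ℂ) (l : Filter ℝ) : Prop where
  tendsto_q : TendstoLocallyUniformly (fun x t => q x t) (fun _ => b) l
  tendsto_dx : TendstoLocallyUniformly (fun x t => dx q x t) (fun _ => 0) l

/-- `ψ` is the `j`-th column of the Jost solution at the point `z` and at the end `l` of the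
`x`-axis, where the potential `q` has the boundary value `b`: it solves both equations of the
Lax pair, and the `j`-th column of `ψ exp(i θ σ₃)` tends to the `j`-th column of `Y`. -/
structure IsJostColumn (q₀ : ℝ) (q : ℝ → ℝ → ℂ) (b : ℂ) (l : Filter ℝ) (j : Fin 2) (z : ℂ)
    (ψ : ℝ → ℝ → Fin 2 → ℂ) : Prop where
  x_equation : ∀ x t, HasDerivAt (fun y => ψ y t) (laxX q₀ z (q x t) *ᵥ ψ x t) x
  t_equation : ∀ x t, HasDerivAt (fun s => ψ x s) (laxT q₀ z (q x t) (dx q x t) *ᵥ ψ x t) t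
  asymptotics : ∀ t, Tendsto
    (fun x => Complex.exp (Complex.I * theta q₀ x t z * sigma3 j j) • ψ x t) l
    (𝓝 (fun i => Ymat z b i j))

/-- The matrix with columns `v` and `w`. -/
def ofCols (v w : Fin 2 → ℂ) : Matrix (Fin 2) (Fin 2) ℂ := !![v 0, w 0; v 1, w 1]

/-- The Wronskian `Wr(v, w) = det (v, w)`. -/
def Wr (v w : Fin 2 → ℂ) : ℂ := (ofCols v w).det

end NZBC

end

/-!
# Jost solutions and scattering coefficients with nonzero boundary conditions

At a fixed time, the spatial equation is compared with its limit at one end of the axis. In the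
basis of the asymptotic eigenvectors `Y`, after removing the phase of one Jost column and orienting
the axis so that the end is at `-∞`, it becomes `wᵢ' = μᵢ wᵢ + (B w)ᵢ`. Here one `μᵢ` vanishes, the
other has nonpositive real part exactly when `z` lies in the region assigned to that column or on
its boundary, and `B` is bounded by a locally bounded function of `z` times `‖q - q±‖`, which is
integrable (`hasDerivAt_wgt`, `pert_norm_le`). The diagonal part then only decreases `‖w‖²`, so an
energy estimate (`wgt_energy_le`) replaces the usual Volterra integral equation. It gives
uniqueness of the Jost column. It also shows that the solutions which have the prescribed form at
the finite points `∓ n` are Cauchy, locally uniformly in `z`, and that their limit is the Jost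
column (`exists_jost_initial`). The approximations are analytic in `z`, because the spatial
equation is affine in `k` and its solutions are therefore entire in `k` (`exists_entire_solution`).
Hence the values of the Jost columns at the origin are continuous up to the boundary, except at the
branch points, and analytic inside.

The Jost column at time `0` is continued in time by the temporal equation, separately at each `x`
(`exists_isJostColumn`). By the zero curvature condition, `X ψ` solves the temporal equation
linearized in `x`, and the theorem on differentiation with respect to a parameter
(`hasDerivAt_param_of_linear`) shows that the spatial equation persists. The asymptotics persist
because the temporal matrix converges, locally uniformly in time, to a limit of which the columns
of `Y` are eigenvectors. No uniformity in time of the integrability of `q - q±` is needed.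

Both matrices of the Lax pair are trace free, so Wronskians of Jost columns do not depend on `x`
and `t` (`IsJostColumn.Wr_const`). Those of the two columns at one end are `γ`, by taking the
limit, and Cramer's rule (`ofCols_eq_mul`) expresses the scattering matrix by the remaining ones.
Evaluated at the origin, they inherit the regularity in `z` of the Jost columns.
-/

noncomputable section

namespace NZBC

/-! ### Linear ordinary differential equations -/

section LinearODE

variable {E : Type*} [NormedAddCommGroup E] [NormedSpace ℝ E]

/-- Two-sided Grönwall inequality around a base point `a`, in a form that is linear in the initial
size `‖d a‖` and in the inhomogeneity `ε`. -/
lemma norm_le_of_norm_deriv_le {d d' : ℝ → E} {a K ε N : ℝ} (hK : 0 ≤ K) (hε : 0 ≤ ε)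
    (hd : ∀ s, HasDerivAt d (d' s) s) (hb : ∀ s, |s - a| ≤ N → ‖d' s‖ ≤ K * ‖d s‖ + ε)
    {s : ℝ} (hs : |s - a| ≤ N) : ‖d s‖ ≤ (‖d a‖ + ε) * Real.exp ((K + 1) * N) := by
  have hN : 0 ≤ N := (abs_nonneg _).trans hs
  have forward : ∀ (f f' : ℝ → E), (∀ r, HasDerivAt f (f' r) r) →
      (∀ r, 0 ≤ r → r ≤ N → ‖f' r‖ ≤ K * ‖f r‖ + ε) → ∀ r, 0 ≤ r → r ≤ N →
      ‖f r‖ ≤ (‖f 0‖ + ε) * Real.exp ((K + 1) * N) := by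
    intro f f' hf hf' r hr hrN
    have := norm_le_gronwallBound_of_norm_deriv_right_le (f := f) (f' := f') (δ := ‖f 0‖)
      (K := K + 1) (ε := ε) (a := 0) (b := N)
      (fun x _ => (hf x).continuousAt.continuousWithinAt)
      (fun x _ => (hf x).hasDerivWithinAt) le_rfl
      (fun x hx => (hf' x hx.1 hx.2.le).trans (by nlinarith [norm_nonneg (f x)])) r ⟨hr, hrN⟩
    rw [gronwallBound_of_K_ne_0 (by positivity), sub_zero] at this
    have h1 : ε / (K + 1) ≤ ε := div_le_self hε (by linarith)
    have h4 : 1 ≤ Real.exp ((K + 1) * r) := Real.one_le_exp (by positivity)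
    calc ‖f r‖ ≤ _ := this
      _ ≤ ‖f 0‖ * Real.exp ((K + 1) * r) + ε * Real.exp ((K + 1) * r) := by
        have := mul_le_mul h1 (sub_le_self (Real.exp ((K + 1) * r)) one_pos.le) (by linarith) hε
        linarith
      _ = (‖f 0‖ + ε) * Real.exp ((K + 1) * r) := by ring
      _ ≤ _ := by gcongr
  -- the two time directions, as forward problems from `0`
  rcases le_total a s with h | h
  · have := forward (fun r => d (a + r)) (fun r => d' (a + r))
      (fun r => by simpa using (hd (a + r)).comp_const_add a r)
      (fun r h0 h1 => hb _ (by simpa [abs_of_nonneg h0] using h1)) (s - a) (by linarith)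
      (by rwa [abs_of_nonneg (by linarith)] at hs)
    simpa using this
  · have := forward (fun r => d (a - r)) (fun r => - d' (a - r))
      (fun r => by simpa using (hd (a - r)).comp_const_sub a r)
      (fun r h0 h1 => by
        rw [norm_neg]; exact hb _ (by simpa [abs_of_nonneg h0] using h1)) (a - s) (by linarith)
      (by rw [abs_of_nonpos (by linarith)] at hs; linarith)
    simpa using this

/-- The terms of the Picard (Peano–Baker) series of the linear equation `u' = A u`, `u a = v`. -/
def picardTerm {𝕜 : Type*} [NontriviallyNormedField 𝕜] [NormedSpace 𝕜 E] (A : ℝ → E →L[𝕜] E)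
    (a : ℝ) (v : E) : ℕ → ℝ → E
  | 0 => fun _ => v
  | n + 1 => fun s => ∫ r in a..s, A r (picardTerm A a v n r)

/-- A linear equation with continuous coefficients has a global solution, the sum of its Picard
series. -/
theorem exists_hasDerivAt_linear {𝕜 : Type*} [NontriviallyNormedField 𝕜] [NormedSpace 𝕜 E]
    [CompleteSpace E] (A : ℝ → E →L[𝕜] E)
    (hA : Continuous A) (a : ℝ) (v : E) :
    ∃ u : ℝ → E, u a = v ∧ ∀ s, HasDerivAt u (A s (u s)) s := by
  set p := picardTerm A a v with hp
  have hcont : ∀ n, Continuous (p n) := by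
    intro n
    induction n with
    | zero => exact continuous_const
    | succ n ih =>
      exact intervalIntegral.continuous_primitive
        (fun _ _ => (hA.clm_apply ih).intervalIntegrable _ _) a
  have hderiv : ∀ n s, HasDerivAt (p (n + 1)) (A s (p n s)) s := fun n s =>
    intervalIntegral.integral_hasDerivAt_right ((hA.clm_apply (hcont n)).intervalIntegrable _ _)
      ((hA.clm_apply (hcont n)).stronglyMeasurableAtFilter _ _)
      (hA.clm_apply (hcont n)).continuousAt
  have hpa : ∀ n, p (n + 1) a = 0 := fun n => by simp [hp, picardTerm]
  have hbd : ∀ N : ℝ, ∃ M : ℝ, 0 ≤ M ∧ ∀ s, |s - a| ≤ N → ‖A s‖ ≤ M := by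
    intro N
    obtain ⟨M, hM⟩ := (isCompact_closedBall a N).exists_bound_of_continuousOn hA.continuousOn
    exact ⟨max M 0, le_max_right _ _, fun s hs => (hM s hs).trans (le_max_left _ _)⟩
  -- the terms of the series are dominated by those of an exponential series
  have hest : ∀ N M : ℝ, 0 ≤ M → (∀ s, |s - a| ≤ N → ‖A s‖ ≤ M) → ∀ n s, |s - a| ≤ N →
      ‖p n s‖ ≤ ‖v‖ * (M * |s - a|) ^ n / n.factorial := by
    intro N M hM0 hM n
    induction n with
    | zero => intro s _; simp [hp, picardTerm]
    | succ n ih =>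
      intro s hs
      have h1 : ‖p (n + 1) s‖ ≤ |∫ r in a..s, M * (‖v‖ * (M * |r - a|) ^ n / n.factorial)| := by
        refine intervalIntegral.norm_integral_le_abs_of_norm_le ?_ ?_
        · refine (ae_restrict_mem measurableSet_uIoc).mono fun r hr => ?_
          have hr' : |r - a| ≤ N := by
            refine le_trans ?_ hs
            have := Set.uIoc_subset_uIcc hr
            exact Set.abs_sub_left_of_mem_uIcc this
          exact ((A r).le_opNorm _).trans
            (mul_le_mul (hM r hr') (ih r hr') (norm_nonneg _) hM0)
        · exact Continuous.intervalIntegrable (by fun_prop) _ _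
      refine h1.trans (le_of_eq ?_)
      rw [intervalIntegral.abs_integral_eq_abs_integral_uIoc]
      have : ∀ r, M * (‖v‖ * (M * |r - a|) ^ n / n.factorial)
          = (M ^ (n + 1) * ‖v‖ / n.factorial) * |r - a| ^ n := by intro r; ring
      simp_rw [this]
      rw [integral_const_mul, integral_pow_abs_sub_uIoc, abs_of_nonneg (by positivity),
        Nat.factorial_succ]
      push_cast
      field_simp
      ring
  have hsum : ∀ s, Summable fun n => p n s := by
    intro s
    obtain ⟨M, hM0, hM⟩ := hbd |s - a|
    refine Summable.of_norm_bounded (g := fun n => ‖v‖ * (M * |s - a|) ^ n / n.factorial) ?_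
      fun n => hest _ M hM0 hM n s le_rfl
    simp_rw [mul_div_assoc]
    exact (Real.summable_pow_div_factorial _).mul_left _
  refine ⟨fun s => v + ∑' n, p (n + 1) s, by simp [hpa], fun s => ?_⟩
  have key : HasDerivAt (fun s => ∑' n, p (n + 1) s) (∑' n, A s (p n s)) s := by
    obtain ⟨M, hM0, hM⟩ := hbd (|s - a| + 1)
    have hopen : IsOpen (Metric.ball a (|s - a| + 1)) := Metric.isOpen_ball
    have hs : s ∈ Metric.ball a (|s - a| + 1) := by simp [Real.dist_eq]
    refine hasDerivAt_tsum_of_isPreconnected (t := Metric.ball a (|s - a| + 1))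
      (u := fun n => M * (‖v‖ * (M * (|s - a| + 1)) ^ n / n.factorial)) ?_ hopen
      (convex_ball _ _).isPreconnected (fun n y _ => hderiv n y) ?_ hs
      ((summable_nat_add_iff 1).2 (hsum s)) hs
    · simp_rw [mul_div_assoc]
      exact ((Real.summable_pow_div_factorial _).mul_left _).mul_left _
    · intro n y hy
      have hy' : |y - a| ≤ |s - a| + 1 := by simpa [Real.dist_eq] using (Metric.mem_ball.1 hy).le
      refine ((A y).le_opNorm _).trans (mul_le_mul (hM y hy') ?_ (norm_nonneg _) hM0)
      refine (hest _ M hM0 hM n y hy').trans ?_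
      gcongr
  have h2 : ∑' n, A s (p n s) = A s (v + ∑' n, p (n + 1) s) := by
    rw [← ContinuousLinearMap.map_tsum _ (hsum s), (hsum s).tsum_eq_zero_add]
    rfl
  rw [← h2]
  exact key.const_add v

/-- Differentiability of the solutions of a linear equation in a (real or complex) parameter: if
the coefficients are differentiable in the parameter, locally uniformly in the independent variable,
then the derivative of the solution is the solution `D` of the linearized equation. -/
theorem hasDerivAt_param_of_linear {𝕜 : Type*} [RCLike 𝕜] [NormedSpace ℂ E] [NormedSpace 𝕜 E]
    [LinearMap.CompatibleSMul E E 𝕜 ℂ] [SMulCommClass ℝ 𝕜 E]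
    (A : 𝕜 → ℝ → E →L[ℂ] E) (A' : ℝ → E →L[ℂ] E) (Φ : 𝕜 → ℝ → E) (D : ℝ → E) (p₀ : 𝕜) (a : ℝ)
    (hA : Continuous (A p₀)) (hA' : Continuous A')
    (hrem : ∀ N : ℝ, ∀ c > 0, ∀ᶠ p in 𝓝 p₀, ∀ s, |s - a| ≤ N → ∀ v,
      ‖A p s v - A p₀ s v - (p - p₀) • A' s v‖ ≤ c * ‖p - p₀‖ * ‖v‖)
    (hΦ : ∀ p s, HasDerivAt (Φ p) (A p s (Φ p s)) s)
    (hD : ∀ s, HasDerivAt D (A p₀ s (D s) + A' s (Φ p₀ s)) s)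
    (h0 : HasDerivAt (fun p => Φ p a) (D a) p₀) (s : ℝ) :
    HasDerivAt (fun p => Φ p s) (D s) p₀ := by
  set N := |s - a| with hN
  have hΦc : Continuous (Φ p₀) := continuous_iff_continuousAt.2 fun r => (hΦ p₀ r).continuousAt
  have hDc : Continuous D := continuous_iff_continuousAt.2 fun r => (hD r).continuousAt
  obtain ⟨M, hM⟩ := (isCompact_closedBall a N).exists_bound_of_continuousOn
    (f := fun r => ‖A p₀ r‖ + ‖A' r‖ + ‖Φ p₀ r‖ + ‖D r‖) (by fun_prop)
  have hM : ∀ r, |r - a| ≤ N → ‖A p₀ r‖ ≤ M ∧ ‖A' r‖ ≤ M ∧ ‖Φ p₀ r‖ ≤ M ∧ ‖D r‖ ≤ M := by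
    intro r hr
    have := (Real.le_norm_self _).trans (hM r hr)
    have h1 := norm_nonneg (A p₀ r)
    have h2 := norm_nonneg (A' r)
    have h3 := norm_nonneg (Φ p₀ r)
    have h4 := norm_nonneg (D r)
    refine ⟨?_, ?_, ?_, ?_⟩ <;> linarith
  have hM0 : 0 ≤ M := (norm_nonneg _).trans (hM s le_rfl).1
  rw [hasDerivAt_iff_isLittleO, Asymptotics.isLittleO_iff] at h0 ⊢
  intro c hc
  set X := Real.exp ((2 * M + 1 + 1) * N) with hX
  have hXpos : 0 < X := Real.exp_pos _
  -- `c₁` is chosen such that the Grönwall bound at the end of the proof is at most `c * ‖h‖`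
  set c₁ := min 1 (c / ((1 + M) ^ 2 * X)) with hc₁
  have hc₁pos : 0 < c₁ := lt_min one_pos (by positivity)
  have hc₁one : c₁ ≤ 1 := min_le_left _ _
  have hc₁c : c₁ * ((1 + M) ^ 2 * X) ≤ c := by
    rw [← le_div_iff₀ (by positivity)]; exact min_le_right _ _
  have hball : ∀ᶠ p in 𝓝 p₀, ‖p - p₀‖ ≤ c₁ := by
    filter_upwards [Metric.closedBall_mem_nhds p₀ hc₁pos] with p hp
    simpa [dist_eq_norm] using hp
  filter_upwards [h0 hc₁pos, hrem N c₁ hc₁pos, hball] with p h0p hp hpb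
  set h := p - p₀ with hh
  -- the Taylor remainder solves the equation at `p` with a small inhomogeneity
  have hd : ∀ r, HasDerivAt (fun r => Φ p r - Φ p₀ r - h • D r)
      (A p r (Φ p r - Φ p₀ r - h • D r) + ((A p r (Φ p₀ r) - A p₀ r (Φ p₀ r) - h • A' r (Φ p₀ r))
        + h • (A p r (D r) - A p₀ r (D r)))) r := by
    intro r
    have h1 := ((hΦ p r).sub (hΦ p₀ r)).sub ((hD r).const_smul h)
    refine h1.congr_deriv ?_
    have hs : A p r (h • D r) = h • A p r (D r) := (A p r).toLinearMap.map_smul_of_tower h (D r)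
    rw [map_sub, map_sub, hs, smul_sub, smul_add]
    abel
  have hdiff : ∀ r, |r - a| ≤ N → ∀ v, ‖A p r v - A p₀ r v‖ ≤ (1 + M) * ‖h‖ * ‖v‖ := by
    intro r hr v
    have h1 := hp r hr v
    have h2 : ‖h • A' r v‖ ≤ ‖h‖ * (M * ‖v‖) := by
      rw [norm_smul]
      gcongr
      exact (A' r).le_of_opNorm_le (hM r hr).2.1 v
    calc ‖A p r v - A p₀ r v‖ = ‖(A p r v - A p₀ r v - h • A' r v) + h • A' r v‖ := by abel_nf
      _ ≤ c₁ * ‖h‖ * ‖v‖ + ‖h‖ * (M * ‖v‖) := (norm_add_le _ _).trans (add_le_add h1 h2)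
      _ ≤ 1 * ‖h‖ * ‖v‖ + ‖h‖ * (M * ‖v‖) := by gcongr
      _ = _ := by ring
  have hop : ∀ r, |r - a| ≤ N → ∀ v, ‖A p r v‖ ≤ (2 * M + 1) * ‖v‖ := by
    intro r hr v
    have h1 := hdiff r hr v
    have h2 : ‖A p₀ r v‖ ≤ M * ‖v‖ := (A p₀ r).le_of_opNorm_le (hM r hr).1 v
    calc ‖A p r v‖ = ‖(A p r v - A p₀ r v) + A p₀ r v‖ := by abel_nf
      _ ≤ (1 + M) * ‖h‖ * ‖v‖ + M * ‖v‖ := (norm_add_le _ _).trans (add_le_add h1 h2)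
      _ ≤ (1 + M) * 1 * ‖v‖ + M * ‖v‖ := by gcongr; exact hpb.trans hc₁one
      _ = _ := by ring
  have hfin := norm_le_of_norm_deriv_le (d := fun r => Φ p r - Φ p₀ r - h • D r)
    (a := a) (K := 2 * M + 1) (ε := c₁ * ‖h‖ * M + ‖h‖ * ((1 + M) * c₁ * M)) (N := N)
    (by positivity) (by positivity) hd ?_ (s := s) le_rfl
  · refine hfin.trans ?_
    have : ‖Φ p a - Φ p₀ a - h • D a‖ ≤ c₁ * ‖h‖ := h0p
    calc _ ≤ (c₁ * ‖h‖ + (c₁ * ‖h‖ * M + ‖h‖ * ((1 + M) * c₁ * M))) * X := by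
          gcongr
      _ = c₁ * ((1 + M) ^ 2 * X) * ‖h‖ := by ring
      _ ≤ c * ‖h‖ := by gcongr
  · intro r hr
    refine (norm_add_le _ _).trans (add_le_add (hop r hr _) ((norm_add_le _ _).trans
      (add_le_add ?_ ?_)))
    · refine (hp r hr _).trans ?_
      gcongr
      exact (hM r hr).2.2.1
    · rw [norm_smul]
      gcongr
      refine (hdiff r hr _).trans ?_
      gcongr
      exact (hM r hr).2.2.2

/-- An inhomogeneous linear equation has global solutions: it is the homogeneous equation for the
pair `(u, τ)` with `u' = A u + τ f` and `τ' = 0`. -/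
theorem exists_hasDerivAt_linear_add [NormedSpace ℂ E] [CompleteSpace E] {A : ℝ → E →L[ℂ] E}
    (hA : Continuous A) {f : ℝ → E} (hf : Continuous f) (a : ℝ) (v : E) :
    ∃ u : ℝ → E, u a = v ∧ ∀ s, HasDerivAt u (A s (u s) + f s) s := by
  obtain ⟨p, hpa, hp⟩ := exists_hasDerivAt_linear (E := E × ℂ)
    (fun s => (ContinuousLinearMap.inl ℂ E ℂ).comp ((A s).comp (ContinuousLinearMap.fst ℂ E ℂ)
      + (ContinuousLinearMap.snd ℂ E ℂ).smulRight (f s))) (by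
        have : Continuous fun s => (ContinuousLinearMap.snd ℂ E ℂ).smulRight (f s) :=
          (ContinuousLinearMap.smulRightL ℂ (E × ℂ) E
            (ContinuousLinearMap.snd ℂ E ℂ)).continuous.comp hf
        fun_prop) a (v, 1)
  have h1 : ∀ s, HasDerivAt (fun s => (p s).1) (A s (p s).1 + (p s).2 • f s) s := fun s =>
    (hp s).fst
  have h2 : ∀ s, HasDerivAt (fun s => (p s).2) 0 s := fun s => (hp s).snd
  have h3 : ∀ s, (p s).2 = 1 := by
    intro s
    have := is_const_of_deriv_eq_zero (fun s => (h2 s).differentiableAt)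
      (fun s => (h2 s).deriv) s a
    simpa [hpa] using this
  exact ⟨fun s => (p s).1, by simp [hpa], fun s => by simpa [h3] using h1 s⟩

/-- The solution operator of a linear equation between two times is bounded. -/
theorem exists_norm_le_of_linear [NormedSpace ℂ E] {A : ℝ → E →L[ℂ] E} (hA : Continuous A)
    (a s : ℝ) : ∃ C : ℝ, 0 ≤ C ∧ ∀ u : ℝ → E, (∀ s, HasDerivAt u (A s (u s)) s) →
      ‖u s‖ ≤ C * ‖u a‖ := by
  obtain ⟨M, hM⟩ := (isCompact_closedBall a |s - a|).exists_bound_of_continuousOn hA.continuousOn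
  refine ⟨Real.exp ((max M 0 + 1) * |s - a|), (Real.exp_pos _).le, fun u hu => ?_⟩
  have := norm_le_of_norm_deriv_le (K := max M 0) (ε := 0) (N := |s - a|) (le_max_right _ _) le_rfl
    hu (fun r hr => by
      rw [add_zero]
      exact (A r).le_of_opNorm_le ((hM r hr).trans (le_max_left _ _)) _) (s := s) le_rfl
  linarith

end LinearODE

/-! ### The Lax pair -/

/-- The operator on `ℂ²` with a given matrix of entries, as a continuous linear function of the
entries. -/
def opL : (Fin 2 → Fin 2 → ℂ) →L[ℂ] ((Fin 2 → ℂ) →L[ℂ] (Fin 2 → ℂ)) :=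
  LinearMap.toContinuousLinearMap
    { toFun := fun M => LinearMap.toContinuousLinearMap (Matrix.mulVecLin (Matrix.of M))
      map_add' := fun M N => ContinuousLinearMap.ext fun v =>
        Matrix.add_mulVec (Matrix.of M) (Matrix.of N) v
      map_smul' := fun c M => ContinuousLinearMap.ext fun v =>
        Matrix.smul_mulVec c (Matrix.of M) v }

lemma opL_apply (M : Matrix (Fin 2) (Fin 2) ℂ) (v : Fin 2 → ℂ) : opL M v = M *ᵥ v := rfl

lemma laxX_eq (q₀ : ℝ) (z w : ℂ) : laxX q₀ z w =
    !![-(Complex.I * kz q₀ z), w; -(starRingEnd ℂ w), Complex.I * kz q₀ z] := by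
  ext i j
  fin_cases i <;> fin_cases j <;> simp [laxX, sigma3, Qmat]

lemma laxT_eq (q₀ : ℝ) (z w wx : ℂ) : laxT q₀ z w wx =
    !![-(Complex.I * kz q₀ z ^ 2) - Complex.I / 2 * (q₀ ^ 2 - w * starRingEnd ℂ w),
        kz q₀ z * w + Complex.I / 2 * wx;
      -(kz q₀ z * starRingEnd ℂ w) + Complex.I / 2 * starRingEnd ℂ wx,
        Complex.I * kz q₀ z ^ 2 + Complex.I / 2 * (q₀ ^ 2 - w * starRingEnd ℂ w)] := by
  ext i j
  fin_cases i <;> fin_cases j <;> simp [laxT, sigma3, Qmat, Matrix.mul_apply, Fin.sum_univ_two] <;>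
    ring_nf

lemma Ymat_eq (z b : ℂ) : Ymat z b =
    !![1, -(Complex.I * b / z); -(Complex.I * starRingEnd ℂ b / z), 1] := by
  ext i j
  fin_cases i <;> fin_cases j <;> simp [Ymat, sigma3, Qmat] <;> ring_nf

/-- The matrix `X` of the `x`-equation as a function of `k`. -/
def matX (k w : ℂ) : Matrix (Fin 2) (Fin 2) ℂ :=
  !![-(Complex.I * k), w; -(starRingEnd ℂ w), Complex.I * k]

lemma laxX_eq_matX (q₀ : ℝ) (z w : ℂ) : laxX q₀ z w = matX (kz q₀ z) w := laxX_eq q₀ z w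

lemma continuous_opL_matX {r : ℝ → ℂ} (hr : Continuous r) (k : ℂ) :
    Continuous fun x => opL (matX k (r x)) := by
  refine opL.continuous.comp (continuous_pi fun i => continuous_pi fun j => ?_)
  have := Complex.continuous_conj.comp hr
  fin_cases i <;> fin_cases j <;> simp only [matX] <;> simpa using by fun_prop

/-- The solutions of the `x`-equation with initial values that do not depend on `k` are entire
functions of `k`. -/
theorem exists_entire_solution {r : ℝ → ℂ} (hr : Continuous r) (a : ℝ) (v : Fin 2 → ℂ) :
    ∃ F : ℂ → ℝ → Fin 2 → ℂ, (∀ k, F k a = v) ∧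
      (∀ k x, HasDerivAt (F k) (matX k (r x) *ᵥ F k x) x) ∧
      ∀ x, Differentiable ℂ fun k => F k x := by
  choose F hFa hF using fun k : ℂ =>
    exists_hasDerivAt_linear (fun x => opL (matX k (r x))) (continuous_opL_matX hr k) a v
  refine ⟨F, hFa, hF, fun x k => ?_⟩
  set M' : Fin 2 → Fin 2 → ℂ := !![-Complex.I, 0; 0, Complex.I] with hM'
  have hFc : Continuous (F k) := continuous_iff_continuousAt.2 fun s => (hF k s).continuousAt
  obtain ⟨D, hDa, hD⟩ := exists_hasDerivAt_linear_add (continuous_opL_matX hr k)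
    ((opL M').continuous.comp hFc) a 0
  refine (hasDerivAt_param_of_linear (fun k x => opL (matX k (r x))) (fun _ => opL M') F D k a
    (continuous_opL_matX hr k) continuous_const ?_ hF hD ?_ x).differentiableAt
  · intro N c hc
    refine Eventually.of_forall fun p s _ v => ?_
    have : opL (matX p (r s)) v - opL (matX k (r s)) v - (p - k) • opL M' v = 0 := by
      ext i
      simp only [Pi.sub_apply, Pi.smul_apply, smul_eq_mul, Pi.zero_apply]
      erw [opL_apply, opL_apply, opL_apply]
      fin_cases i <;> simp [matX, hM', Matrix.mulVec, dotProduct, Fin.sum_univ_two] <;>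
        ring
    rw [this, norm_zero]
    positivity
  · simp only [hFa, hDa]
    exact hasDerivAt_const _ _

/-! ### The energy estimate -/

/-- Energy estimate for a system `dᵢ' = μᵢ dᵢ + (B d)ᵢ + hᵢ` with `Re μᵢ ≤ 0`: the diagonal part
does not increase `‖d₀‖² + ‖d₁‖²`, so that only the integral `I` of the size `β` of the perturbation
enters the bound. -/
theorem energy_le {d₀ d₁ b₀₀ b₀₁ b₁₀ b₁₁ h₀ h₁ : ℝ → ℂ} {μ₀ μ₁ : ℂ} {β I : ℝ → ℝ} {c : ℝ}
    (hμ₀ : μ₀.re ≤ 0) (hμ₁ : μ₁.re ≤ 0)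
    (hd₀ : ∀ y, HasDerivAt d₀ (μ₀ * d₀ y + (b₀₀ y * d₀ y + b₀₁ y * d₁ y + h₀ y)) y)
    (hd₁ : ∀ y, HasDerivAt d₁ (μ₁ * d₁ y + (b₁₀ y * d₀ y + b₁₁ y * d₁ y + h₁ y)) y)
    (hI : ∀ y, HasDerivAt I (β y) y)
    (h₀₀ : ∀ y, ‖b₀₀ y‖ ≤ β y / 2) (h₀₁ : ∀ y, ‖b₀₁ y‖ ≤ β y / 2)
    (h₁₀ : ∀ y, ‖b₁₀ y‖ ≤ β y / 2) (h₁₁ : ∀ y, ‖b₁₁ y‖ ≤ β y / 2)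
    (hh₀ : ∀ y, ‖h₀ y‖ ≤ β y / 2 * c) (hh₁ : ∀ y, ‖h₁ y‖ ≤ β y / 2 * c)
    {y y' : ℝ} (hy : y ≤ y') :
    ‖d₀ y'‖ ^ 2 + ‖d₁ y'‖ ^ 2 + c ^ 2
      ≤ (‖d₀ y‖ ^ 2 + ‖d₁ y‖ ^ 2 + c ^ 2) * Real.exp (3 * (I y' - I y)) := by
  -- the diagonal term contributes `Re μ * ‖d‖²`, which is not positive
  have aux : ∀ (μ d g : ℂ), μ.re ≤ 0 → 2 * inner ℝ d (μ * d + g) ≤ 2 * (‖d‖ * ‖g‖) := by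
    intro μ d g hμ
    have h1 : inner ℝ d (μ * d) ≤ 0 := by
      have : inner ℝ d (μ * d) = μ.re * ‖d‖ ^ 2 := by
        rw [Complex.inner, ← Complex.normSq_eq_norm_sq, Complex.normSq_apply]
        simp
        ring
      rw [this]
      exact mul_nonpos_of_nonpos_of_nonneg hμ (by positivity)
    rw [inner_add_right]
    have := real_inner_le_norm d g
    linarith
  have key : ∀ x, HasDerivAt
      (fun y => (‖d₀ y‖ ^ 2 + ‖d₁ y‖ ^ 2 + c ^ 2) * Real.exp (-(3 * I y))) _ x :=
    fun x => (((hd₀ x).norm_sq.add (hd₁ x).norm_sq).add_const (c ^ 2)).mul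
      ((hI x).const_mul 3).neg.exp
  have anti : Antitone
      (fun y => (‖d₀ y‖ ^ 2 + ‖d₁ y‖ ^ 2 + c ^ 2) * Real.exp (-(3 * I y))) := by
    refine antitone_of_deriv_nonpos (fun x => (key x).differentiableAt) fun x => ?_
    rw [(key x).deriv]
    have hβ : 0 ≤ β x := by linarith [(norm_nonneg _).trans (h₀₀ x)]
    have e₀ := aux μ₀ (d₀ x) (b₀₀ x * d₀ x + b₀₁ x * d₁ x + h₀ x) hμ₀
    have e₁ := aux μ₁ (d₁ x) (b₁₀ x * d₀ x + b₁₁ x * d₁ x + h₁ x) hμ₁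
    have n₀ : ‖b₀₀ x * d₀ x + b₀₁ x * d₁ x + h₀ x‖ ≤ β x / 2 * (‖d₀ x‖ + ‖d₁ x‖ + c) := by
      refine (norm_add₃_le).trans ?_
      rw [norm_mul, norm_mul, mul_add, mul_add]
      gcongr
      exacts [h₀₀ x, h₀₁ x, hh₀ x]
    have n₁ : ‖b₁₀ x * d₀ x + b₁₁ x * d₁ x + h₁ x‖ ≤ β x / 2 * (‖d₀ x‖ + ‖d₁ x‖ + c) := by
      refine (norm_add₃_le).trans ?_
      rw [norm_mul, norm_mul, mul_add, mul_add]
      gcongr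
      exacts [h₁₀ x, h₁₁ x, hh₁ x]
    have m₀ := mul_le_mul_of_nonneg_left n₀ (norm_nonneg (d₀ x))
    have m₁ := mul_le_mul_of_nonneg_left n₁ (norm_nonneg (d₁ x))
    set p := ‖d₀ x‖
    set r := ‖d₁ x‖
    have q : (p + r) * (p + r + c) ≤ 3 * (p ^ 2 + r ^ 2 + c ^ 2) := by
      nlinarith [sq_nonneg (p - r), sq_nonneg (p - c), sq_nonneg (r - c), sq_nonneg c]
    have q' := mul_le_mul_of_nonneg_left q hβ
    have hle : 2 * inner ℝ (d₀ x) (μ₀ * d₀ x + (b₀₀ x * d₀ x + b₀₁ x * d₁ x + h₀ x))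
        + 2 * inner ℝ (d₁ x) (μ₁ * d₁ x + (b₁₀ x * d₀ x + b₁₁ x * d₁ x + h₁ x))
        ≤ 3 * β x * (p ^ 2 + r ^ 2 + c ^ 2) := by nlinarith
    have := mul_le_mul_of_nonneg_right hle (Real.exp_pos (-(3 * I x))).le
    simp only [Pi.add_apply, Pi.neg_apply]
    linarith
  have h1 := mul_le_mul_of_nonneg_right (anti hy) (Real.exp_pos (3 * I y')).le
  simp only [mul_assoc, ← Real.exp_add] at h1
  rw [neg_add_cancel, Real.exp_zero, mul_one] at h1
  refine h1.trans (le_of_eq ?_)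
  ring_nf

/-! ### Solutions of the spatial equation near infinity -/

/-- The sign `± 1` on the diagonal of `σ₃`. -/
def sg (j : Fin 2) : ℝ := if j = 0 then 1 else -1

lemma sg_zero : sg 0 = 1 := rfl

lemma sg_one : sg 1 = -1 := rfl

lemma sigma3_diag (j : Fin 2) : sigma3 j j = (sg j : ℂ) := by
  fin_cases j <;> simp [sigma3, sg]

/-- The coordinates of a function `u`, multiplied by the exponential that removes the phase of the
`j`-th Jost column, in the basis of the asymptotic eigenvectors `Y`. The variable is `y = ε x`, so
that `y → -∞` is the end `x → -∞` for `ε = 1` and the end `x → ∞` for `ε = -1`. -/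
def wgt (q₀ : ℝ) (b : ℂ) (ε : ℝ) (j : Fin 2) (z : ℂ) (u : ℝ → Fin 2 → ℂ) (y : ℝ) : Fin 2 → ℂ :=
  (Complex.exp (Complex.I * lam q₀ z * sg j * (ε * y)) / gam q₀ z) •
    ![u (ε * y) 0 + Complex.I * b / z * u (ε * y) 1,
      Complex.I * starRingEnd ℂ b / z * u (ε * y) 0 + u (ε * y) 1]

section spatial

variable {q₀ : ℝ} {b : ℂ} {ε : ℝ} {j : Fin 2} {z : ℂ}

lemma mul_conj_of_norm (hb : ‖b‖ = q₀) : b * starRingEnd ℂ b = (q₀ : ℂ) ^ 2 := by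
  rw [Complex.mul_conj, Complex.normSq_eq_norm_sq, hb]
  push_cast
  rfl

lemma Ymat_mulVec_wgt (hz : z ≠ 0) (hγ : gam q₀ z ≠ 0) (hb : ‖b‖ = q₀) (u : ℝ → Fin 2 → ℂ)
    (y : ℝ) : Ymat z b *ᵥ wgt q₀ b ε j z u y
      = Complex.exp (Complex.I * lam q₀ z * sg j * (ε * y)) • u (ε * y) := by
  have hbb := mul_conj_of_norm hb
  set e := Complex.exp (Complex.I * lam q₀ z * sg j * (ε * y)) with he
  have hI := Complex.I_sq
  have hg : gam q₀ z * z ^ 2 = z ^ 2 + q₀ ^ 2 := by rw [gam]; field_simp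
  ext i
  fin_cases i
  · simp [Ymat_eq, wgt, Matrix.mulVec, dotProduct, Fin.sum_univ_two, ← he]
    field_simp
    linear_combination e * u (ε * y) 0 * (hbb - b * starRingEnd ℂ b * hI - hg)
  · simp [Ymat_eq, wgt, Matrix.mulVec, dotProduct, Fin.sum_univ_two, ← he]
    field_simp
    linear_combination e * u (ε * y) 1 * (hbb - b * starRingEnd ℂ b * hI - hg)

/-- The diagonal entries of the system for `wgt`. -/
def muw (q₀ : ℝ) (ε : ℝ) (j : Fin 2) (z : ℂ) (i : Fin 2) : ℂ :=
  (ε * (sg j - sg i) : ℝ) * (Complex.I * lam q₀ z)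

lemma muw_self : muw q₀ ε j z j = 0 := by simp [muw]

lemma muw_re (h : 0 ≤ ε * sg j * (lam q₀ z).im) (i : Fin 2) : (muw q₀ ε j z i).re ≤ 0 := by
  rw [muw, Complex.re_ofReal_mul]
  fin_cases i <;> fin_cases j <;> simp [sg] at h ⊢ <;> linarith

/-- The perturbation in the system for `wgt`, which is linear in the deviation `p` of the potential
from its boundary value. -/
def pert (q₀ : ℝ) (b : ℂ) (ε : ℝ) (z p : ℂ) : Matrix (Fin 2) (Fin 2) ℂ :=
  (ε / gam q₀ z) •
    !![-(Complex.I / z * (starRingEnd ℂ b * p + b * starRingEnd ℂ p)),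
        p - b ^ 2 * starRingEnd ℂ p / z ^ 2;
      starRingEnd ℂ b ^ 2 * p / z ^ 2 - starRingEnd ℂ p,
        Complex.I / z * (starRingEnd ℂ b * p + b * starRingEnd ℂ p)]

lemma hasDerivAt_wgt (hz : z ≠ 0) (hγ : gam q₀ z ≠ 0) (hb : ‖b‖ = q₀) {r : ℝ → ℂ}
    {u : ℝ → Fin 2 → ℂ} (hu : ∀ x, HasDerivAt u (laxX q₀ z (r x) *ᵥ u x) x) (i : Fin 2) (y : ℝ) :
    HasDerivAt (fun y => wgt q₀ b ε j z u y i)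
      (muw q₀ ε j z i * wgt q₀ b ε j z u y i
        + (pert q₀ b ε z (r (ε * y) - b) i 0 * wgt q₀ b ε j z u y 0
          + pert q₀ b ε z (r (ε * y) - b) i 1 * wgt q₀ b ε j z u y 1)) y := by
  have hbb := mul_conj_of_norm hb
  have hy : HasDerivAt (fun y : ℝ => ε * y) ε y := by
    simpa using (hasDerivAt_id y).const_mul ε
  have hu' : ∀ l, HasDerivAt (fun y => u (ε * y) l)
      (ε * (laxX q₀ z (r (ε * y)) *ᵥ u (ε * y)) l) y := by
    intro l
    have := (hasDerivAt_pi.1 (hu (ε * y)) l).scomp y hy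
    simpa [Function.comp_def] using this
  have hu0 := hu' 0
  have hu1 := hu' 1
  have he : HasDerivAt
      (fun y : ℝ => Complex.exp (Complex.I * lam q₀ z * sg j * (ε * y)) / gam q₀ z)
      (Complex.exp (Complex.I * lam q₀ z * sg j * (ε * y)) * (Complex.I * lam q₀ z * sg j * ε)
        / gam q₀ z) y := by
    have := (((hasDerivAt_id y).ofReal_comp.const_mul (ε : ℂ)).const_mul
      (Complex.I * lam q₀ z * sg j)).cexp.div_const (gam q₀ z)
    simpa using this
  set e := Complex.exp (Complex.I * lam q₀ z * sg j * (ε * y)) with hedef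
  simp only [laxX_eq, Matrix.mulVec, dotProduct, Fin.sum_univ_two, Matrix.of_apply,
    Matrix.cons_val', Matrix.cons_val_zero, Matrix.cons_val_one, Matrix.cons_val_fin_one] at hu0 hu1
  generalize hU0 : u (ε * y) 0 = U₀ at hu0 hu1
  generalize hU1 : u (ε * y) 1 = U₁ at hu0 hu1
  generalize hR : r (ε * y) = R at hu0 hu1 ⊢
  set g := gam q₀ z with hgdef
  have hcb : starRingEnd ℂ (R - b) = starRingEnd ℂ R - starRingEnd ℂ b := map_sub _ _ _
  generalize starRingEnd ℂ R = R' at hu0 hu1 hcb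
  fin_cases i
  · have := he.mul (hu0.add (hu1.const_mul (Complex.I * b / z)))
    simp only [wgt, pert, muw, hcb, ← hedef, ← hgdef]
    generalize starRingEnd ℂ b = b' at hbb hcb ⊢
    have hA : g * (-(Complex.I * kz q₀ z) * U₀ + R * U₁ + Complex.I * b / z * (-R' * U₀
        + Complex.I * kz q₀ z * U₁) + Complex.I * lam q₀ z * (U₀ + Complex.I * b / z * U₁))
        = -(Complex.I / z * (b' * (R - b) + b * (R' - b'))) * (U₀ + Complex.I * b / z * U₁)
          + (R - b - b ^ 2 * (R' - b') / z ^ 2) * (Complex.I * b' / z * U₀ + U₁) := by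
      rw [hgdef, gam, kz, lam, ← hbb]
      field_simp
      ring_nf
      simp only [Complex.I_sq]
      ring_nf
    simp only [Fin.zero_eta, Pi.smul_apply, Matrix.cons_val_zero, smul_eq_mul, Matrix.smul_apply,
      Matrix.of_apply, Matrix.cons_val', Matrix.cons_val_one, Matrix.cons_val_fin_one, hU0, hU1]
    refine this.congr_deriv ?_
    have hA' := eq_div_of_mul_eq hγ ((mul_comm _ _).trans hA)
    simp only [Pi.add_apply, hU0, hU1, ← hedef, sg_zero]
    push_cast
    linear_combination (ε * e / g) * hA'
  · have := he.mul ((hu0.const_mul (Complex.I * starRingEnd ℂ b / z)).add hu1)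
    simp only [wgt, pert, muw, hcb, ← hedef, ← hgdef]
    generalize starRingEnd ℂ b = b' at hbb hcb this ⊢
    have hA : g * (Complex.I * b' / z * (-(Complex.I * kz q₀ z) * U₀ + R * U₁) + (-R' * U₀
        + Complex.I * kz q₀ z * U₁) - Complex.I * lam q₀ z * (Complex.I * b' / z * U₀ + U₁))
        = (b' ^ 2 * (R - b) / z ^ 2 - (R' - b')) * (U₀ + Complex.I * b / z * U₁)
          + (Complex.I / z * (b' * (R - b) + b * (R' - b'))) * (Complex.I * b' / z * U₀ + U₁) := by
      rw [hgdef, gam, kz, lam, ← hbb]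
      field_simp
      ring_nf
      simp only [Complex.I_sq]
      ring_nf
    simp only [Fin.mk_one, Pi.smul_apply, Matrix.cons_val_zero, smul_eq_mul, Matrix.smul_apply,
      Matrix.of_apply, Matrix.cons_val', Matrix.cons_val_one, Matrix.cons_val_fin_one, hU0, hU1]
    refine this.congr_deriv ?_
    have hA' := eq_div_of_mul_eq hγ ((mul_comm _ _).trans hA)
    simp only [Pi.add_apply, hU0, hU1, ← hedef, sg_one]
    push_cast
    linear_combination (ε * e / g) * hA'

/-- The factor by which the deviation of the potential enters the estimates at the point `z`. -/
def pertC (q₀ : ℝ) (z : ℂ) : ℝ := 2 * (1 + q₀ / ‖z‖) ^ 2 / ‖gam q₀ z‖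

lemma pertC_nonneg : 0 ≤ pertC q₀ z := by unfold pertC; positivity

lemma pert_norm_le (hb : ‖b‖ = q₀) (hε : |ε| = 1) (p : ℂ) (i l : Fin 2) :
    ‖pert q₀ b ε z p i l‖ ≤ pertC q₀ z * ‖p‖ / 2 := by
  have hq : 0 ≤ q₀ := hb ▸ norm_nonneg b
  have hm : ‖(ε / gam q₀ z : ℂ)‖ = 1 / ‖gam q₀ z‖ := by simp [hε]
  have h1 : ‖Complex.I / z * (starRingEnd ℂ b * p + b * starRingEnd ℂ p)‖
      ≤ (1 + q₀ / ‖z‖) ^ 2 * ‖p‖ := by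
    rw [norm_mul, norm_div, Complex.norm_I]
    have : ‖starRingEnd ℂ b * p + b * starRingEnd ℂ p‖ ≤ 2 * q₀ * ‖p‖ := by
      refine (norm_add_le _ _).trans (le_of_eq ?_)
      simp only [norm_mul, RCLike.norm_conj, hb]
      ring
    calc 1 / ‖z‖ * _ ≤ 1 / ‖z‖ * (2 * q₀ * ‖p‖) := by gcongr
      _ = (2 * (q₀ / ‖z‖)) * ‖p‖ := by ring
      _ ≤ _ := by
        gcongr
        nlinarith [sq_nonneg (q₀ / ‖z‖)]
  have hle : 1 + q₀ ^ 2 / ‖z‖ ^ 2 ≤ (1 + q₀ / ‖z‖) ^ 2 := by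
    rw [← div_pow]
    have : 0 ≤ q₀ / ‖z‖ := by positivity
    nlinarith
  have h2 : ‖p - b ^ 2 * starRingEnd ℂ p / z ^ 2‖ ≤ (1 + q₀ / ‖z‖) ^ 2 * ‖p‖ := by
    calc ‖p - b ^ 2 * starRingEnd ℂ p / z ^ 2‖ ≤ _ := norm_sub_le _ _
      _ = (1 + q₀ ^ 2 / ‖z‖ ^ 2) * ‖p‖ := by
        simp only [norm_div, norm_mul, norm_pow, RCLike.norm_conj, hb]
        ring
      _ ≤ _ := by gcongr
  have h3 : ‖starRingEnd ℂ b ^ 2 * p / z ^ 2 - starRingEnd ℂ p‖ ≤ (1 + q₀ / ‖z‖) ^ 2 * ‖p‖ := by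
    calc ‖starRingEnd ℂ b ^ 2 * p / z ^ 2 - starRingEnd ℂ p‖ ≤ _ := norm_sub_le _ _
      _ = (1 + q₀ ^ 2 / ‖z‖ ^ 2) * ‖p‖ := by
        simp only [norm_div, norm_mul, norm_pow, RCLike.norm_conj, hb]
        ring
      _ ≤ _ := by gcongr
  have main : ∀ w : ℂ, ‖w‖ ≤ (1 + q₀ / ‖z‖) ^ 2 * ‖p‖ →
      ‖(ε / gam q₀ z : ℂ) * w‖ ≤ pertC q₀ z * ‖p‖ / 2 := by
    intro w hw
    rw [norm_mul, hm]
    calc 1 / ‖gam q₀ z‖ * ‖w‖ ≤ 1 / ‖gam q₀ z‖ * ((1 + q₀ / ‖z‖) ^ 2 * ‖p‖) := by gcongr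
      _ = _ := by rw [pertC]; ring
  simp only [pert, Matrix.smul_apply, smul_eq_mul]
  fin_cases i <;> fin_cases l
  · exact main _ ((norm_neg _).trans_le h1)
  · exact main _ h2
  · exact main _ h3
  · exact main _ h1

/-- The primitive of the deviation of the potential from its boundary value. -/
def devInt (r : ℝ → ℂ) (b : ℂ) (ε y : ℝ) : ℝ := ∫ s in (0 : ℝ)..y, ‖r (ε * s) - b‖

lemma hasDerivAt_devInt {r : ℝ → ℂ} (hr : Continuous r) (b : ℂ) (ε y : ℝ) :
    HasDerivAt (devInt r b ε) ‖r (ε * y) - b‖ y := by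
  have hc : Continuous fun s => ‖r (ε * s) - b‖ := by fun_prop
  exact intervalIntegral.integral_hasDerivAt_right (hc.intervalIntegrable _ _)
    (hc.stronglyMeasurableAtFilter _ _) hc.continuousAt

/-- The square of the Euclidean norm on `ℂ²`. -/
def nsq (v : Fin 2 → ℂ) : ℝ := ‖v 0‖ ^ 2 + ‖v 1‖ ^ 2

lemma nsq_nonneg (v : Fin 2 → ℂ) : 0 ≤ nsq v := by unfold nsq; positivity

/-- The energy estimate for the deviation of a solution of the spatial equation from `c` times the
asymptotic eigenvector. The case `c = 0` compares two solutions, and the case `c = 1` controls the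
asymptotics. -/
theorem wgt_energy_le (hz : z ≠ 0) (hγ : gam q₀ z ≠ 0) (hb : ‖b‖ = q₀) (hε : |ε| = 1)
    (hl : 0 ≤ ε * sg j * (lam q₀ z).im) {r : ℝ → ℂ} (hr : Continuous r)
    {u : ℝ → Fin 2 → ℂ} (hu : ∀ x, HasDerivAt u (laxX q₀ z (r x) *ᵥ u x) x)
    {c : ℝ} (hc : 0 ≤ c) {y y' : ℝ} (hy : y ≤ y') :
    nsq (wgt q₀ b ε j z u y' - Pi.single j (c : ℂ)) + c ^ 2
      ≤ (nsq (wgt q₀ b ε j z u y - (Pi.single j (c : ℂ) : Fin 2 → ℂ)) + c ^ 2)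
        * Real.exp (3 * pertC q₀ z * (devInt r b ε y' - devInt r b ε y)) := by
  -- the constant vector is annihilated by the diagonal part, since `muw` vanishes at the index `j`
  have hd : ∀ i y, HasDerivAt
      (fun y => (wgt q₀ b ε j z u y - (Pi.single j (c : ℂ) : Fin 2 → ℂ)) i)
      (muw q₀ ε j z i * (wgt q₀ b ε j z u y - (Pi.single j (c : ℂ) : Fin 2 → ℂ)) i
        + (pert q₀ b ε z (r (ε * y) - b) i 0
            * (wgt q₀ b ε j z u y - (Pi.single j (c : ℂ) : Fin 2 → ℂ)) 0
          + pert q₀ b ε z (r (ε * y) - b) i 1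
            * (wgt q₀ b ε j z u y - (Pi.single j (c : ℂ) : Fin 2 → ℂ)) 1
          + pert q₀ b ε z (r (ε * y) - b) i j * c)) y := by
    intro i y
    refine ((hasDerivAt_wgt hz hγ hb hu i y).sub_const _).congr_deriv ?_
    have hμ : muw q₀ ε j z i * (Pi.single j (c : ℂ) : Fin 2 → ℂ) i = 0 := by
      rcases eq_or_ne i j with rfl | h
      · simp [muw_self]
      · simp [h]
    have hj : pert q₀ b ε z (r (ε * y) - b) i 0 * (Pi.single j (c : ℂ) : Fin 2 → ℂ) 0
        + pert q₀ b ε z (r (ε * y) - b) i 1 * (Pi.single j (c : ℂ) : Fin 2 → ℂ) 1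
        = pert q₀ b ε z (r (ε * y) - b) i j * c := by
      fin_cases j <;> simp
    simp only [Pi.sub_apply]
    linear_combination hμ + hj
  have hB : ∀ i l y, ‖pert q₀ b ε z (r (ε * y) - b) i l‖
      ≤ pertC q₀ z * ‖r (ε * y) - b‖ / 2 := fun i l y => pert_norm_le hb hε _ i l
  have hh : ∀ i y, ‖pert q₀ b ε z (r (ε * y) - b) i j * c‖
      ≤ pertC q₀ z * ‖r (ε * y) - b‖ / 2 * c := by
    intro i y
    rw [norm_mul, Complex.norm_real, Real.norm_of_nonneg hc]
    gcongr
    exact hB i j y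
  have := energy_le (c := c) (muw_re hl 0) (muw_re hl 1) (hd 0) (hd 1)
    (fun y => (hasDerivAt_devInt hr b ε y).const_mul (pertC q₀ z))
    (hB 0 0) (hB 0 1) (hB 1 0) (hB 1 1) (hh 0) (hh 1) hy
  refine this.trans (le_of_eq ?_)
  rw [nsq]
  ring_nf

/-! ### Jost columns at a fixed time -/

lemma norm_le_sqrt_nsq (v : Fin 2 → ℂ) : ‖v‖ ≤ Real.sqrt (nsq v) := by
  refine (pi_norm_le_iff_of_nonneg (Real.sqrt_nonneg _)).2 fun i => Real.le_sqrt_of_sq_le ?_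
  unfold nsq
  fin_cases i <;> simp

lemma wgt_sub (u v : ℝ → Fin 2 → ℂ) (y : ℝ) :
    wgt q₀ b ε j z (fun x => u x - v x) y = wgt q₀ b ε j z u y - wgt q₀ b ε j z v y := by
  ext i
  fin_cases i <;> simp [wgt] <;> ring

lemma wgt_eq_mulVec (u : ℝ → Fin 2 → ℂ) (y : ℝ) : wgt q₀ b ε j z u y
    = ((gam q₀ z)⁻¹ • !![1, Complex.I * b / z; Complex.I * starRingEnd ℂ b / z, 1]) *ᵥ
      (Complex.exp (Complex.I * lam q₀ z * sg j * (ε * y)) • u (ε * y)) := by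
  ext i
  fin_cases i <;> simp [wgt, Matrix.mulVec, dotProduct, Fin.sum_univ_two] <;> ring

lemma wgt_eq_single (hz : z ≠ 0) (hγ : gam q₀ z ≠ 0) (hb : ‖b‖ = q₀) {u : ℝ → Fin 2 → ℂ} {y : ℝ}
    (h : Complex.exp (Complex.I * lam q₀ z * sg j * (ε * y)) • u (ε * y) = fun i => Ymat z b i j) :
    wgt q₀ b ε j z u y = Pi.single j 1 := by
  have hbb := mul_conj_of_norm hb
  have hI := Complex.I_sq
  have hg : gam q₀ z * z ^ 2 = z ^ 2 + q₀ ^ 2 := by rw [gam]; field_simp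
  rw [wgt_eq_mulVec, h]
  ext i
  fin_cases i <;> fin_cases j <;>
    simp [Ymat_eq, Matrix.mulVec, dotProduct, Fin.sum_univ_two] <;> field_simp
  · linear_combination hbb - b * starRingEnd ℂ b * hI - hg
  · linear_combination hbb - b * starRingEnd ℂ b * hI - hg

lemma devInt_zero (r : ℝ → ℂ) (b : ℂ) (ε : ℝ) : devInt r b ε 0 = 0 := by simp [devInt]

lemma devInt_mono {r : ℝ → ℂ} (hr : Continuous r) (b : ℂ) (ε : ℝ) : Monotone (devInt r b ε) :=
  monotone_of_deriv_nonneg (fun y => (hasDerivAt_devInt hr b ε y).differentiableAt)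
    fun y => by rw [(hasDerivAt_devInt hr b ε y).deriv]; positivity

lemma exists_tendsto_devInt {r : ℝ → ℂ}
    (hi : IntegrableOn (fun y => r (ε * y) - b) (Set.Iic 0)) :
    ∃ J, Tendsto (devInt r b ε) atBot (𝓝 J) := by
  refine ⟨_, ((intervalIntegral_tendsto_integral_Iic 0 hi.norm tendsto_id).neg).congr fun y => ?_⟩
  exact (intervalIntegral.integral_symm y 0).symm

/-- A solution of the spatial equation with a decaying weighted form vanishes: the energy estimate
carries the decay from `-∞` to any finite point. -/
theorem eq_zero_of_tendsto (hz : z ≠ 0) (hγ : gam q₀ z ≠ 0) (hb : ‖b‖ = q₀) (hε : |ε| = 1)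
    (hl : 0 ≤ ε * sg j * (lam q₀ z).im) {r : ℝ → ℂ} (hr : Continuous r) {J : ℝ}
    (hJ : Tendsto (devInt r b ε) atBot (𝓝 J))
    {u : ℝ → Fin 2 → ℂ} (hu : ∀ x, HasDerivAt u (laxX q₀ z (r x) *ᵥ u x) x)
    (h0 : Tendsto (fun y : ℝ => Complex.exp (Complex.I * lam q₀ z * sg j * (ε * y)) • u (ε * y))
      atBot (𝓝 0)) (x : ℝ) : u x = 0 := by
  have hw : Tendsto (wgt q₀ b ε j z u) atBot (𝓝 0) := by
    simp_rw [funext (wgt_eq_mulVec (q₀ := q₀) (b := b) (ε := ε) (j := j) (z := z) u)]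
    have hc : Continuous fun v : Fin 2 → ℂ => ((gam q₀ z)⁻¹ •
      !![1, Complex.I * b / z; Complex.I * starRingEnd ℂ b / z, 1]) *ᵥ v := by fun_prop
    simpa only [Matrix.mulVec_zero, Function.comp_def] using (hc.tendsto 0).comp h0
  have hn : Tendsto (fun y => nsq (wgt q₀ b ε j z u y)) atBot (𝓝 0) := by
    have hc : Continuous nsq := by unfold nsq; fun_prop
    have h2 : nsq 0 = 0 := by simp [nsq]
    exact h2 ▸ (hc.tendsto 0).comp hw
  have hε2 : ε * ε = 1 := by rw [← abs_mul_abs_self, hε, one_mul]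
  have hle : nsq (wgt q₀ b ε j z u (ε * x)) ≤ 0 := by
    have hlim := hn.mul ((((tendsto_const_nhds (x := devInt r b ε (ε * x))).sub hJ).const_mul
      (3 * pertC q₀ z)).rexp)
    rw [zero_mul] at hlim
    refine ge_of_tendsto hlim ?_
    filter_upwards [eventually_le_atBot (ε * x)] with y hy
    simpa using wgt_energy_le hz hγ hb hε hl hr hu le_rfl hy
  have hw0 : wgt q₀ b ε j z u (ε * x) = 0 := by
    have := norm_le_sqrt_nsq (wgt q₀ b ε j z u (ε * x))
    rw [Real.sqrt_eq_zero_of_nonpos hle] at this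
    exact norm_le_zero_iff.1 this
  have := Ymat_mulVec_wgt (j := j) (ε := ε) hz hγ hb u (ε * x)
  rw [hw0, Matrix.mulVec_zero, show ε * (ε * x) = x by rw [← mul_assoc, hε2, one_mul]] at this
  exact (smul_eq_zero.1 this.symm).resolve_left (Complex.exp_ne_zero _)

/-- The points of the uniformization plane at which the exponential that is opposite to the phase of
a Jost column does not grow towards the end where the column is normalized; `τ` is the product of
the sign of the end and of the sign of the column. -/
def jostDom (q₀ τ : ℝ) : Set ℂ := {z | z ≠ 0 ∧ gam q₀ z ≠ 0 ∧ 0 ≤ τ * (lam q₀ z).im}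

lemma differentiableAt_lam (hz : z ≠ 0) : DifferentiableAt ℂ (lam q₀) z := by
  unfold lam; fun_prop (disch := assumption)

lemma differentiableAt_kz (hz : z ≠ 0) : DifferentiableAt ℂ (kz q₀) z := by
  unfold kz; fun_prop (disch := assumption)

lemma differentiableAt_gam (hz : z ≠ 0) : DifferentiableAt ℂ (gam q₀) z := by
  unfold gam; fun_prop (disch := simpa using hz)

lemma differentiableAt_Ymat (hz : z ≠ 0) (i j : Fin 2) :
    DifferentiableAt ℂ (fun z => Ymat z b i j) z := by
  fin_cases i <;> fin_cases j <;> simp [Ymat_eq] <;> fun_prop (disch := assumption)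

lemma continuousAt_pertC (hz : z ≠ 0) (hγ : gam q₀ z ≠ 0) : ContinuousAt (pertC q₀) z := by
  have := (differentiableAt_gam (q₀ := q₀) hz).continuousAt
  unfold pertC
  fun_prop (disch := simpa using by assumption)

/-- The initial values at `0` of the Jost columns at a fixed time, as a function of `z`. They are
the locally uniform limits of the values at `0` of the solutions that have the prescribed asymptotic
form at the finite points `-ε n`. -/
theorem exists_jost_initial (hb : ‖b‖ = q₀) (hε : |ε| = 1) {r : ℝ → ℂ} (hr : Continuous r) {J : ℝ}
    (hJ : Tendsto (devInt r b ε) atBot (𝓝 J)) :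
    ∃ g : ℂ → Fin 2 → ℂ,
      (∀ z ∈ jostDom q₀ (ε * sg j), ∀ u : ℝ → Fin 2 → ℂ,
        (∀ x, HasDerivAt u (laxX q₀ z (r x) *ᵥ u x) x) → u 0 = g z →
        Tendsto (fun y : ℝ => Complex.exp (Complex.I * lam q₀ z * sg j * (ε * y)) • u (ε * y)) atBot
          (𝓝 fun i => Ymat z b i j)) ∧
      ContinuousOn g (jostDom q₀ (ε * sg j)) ∧
      ∀ U, IsOpen U → U ⊆ jostDom q₀ (ε * sg j) → DifferentiableOn ℂ g U := by
  have hq : 0 ≤ q₀ := hb ▸ norm_nonneg b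
  have hJle : ∀ y, J ≤ devInt r b ε y := fun y => (devInt_mono hr b ε).le_of_tendsto hJ y
  have hJ0 : J ≤ 0 := devInt_zero r b ε ▸ hJle 0
  choose F hFa hF hFd using fun (n : ℕ) (i : Fin 2) =>
    exists_entire_solution hr (ε * (-(n : ℝ))) (Pi.single i 1)
  -- `U n z` is the solution with the asymptotic form of the Jost column at the point `-ε n`
  set U : ℕ → ℂ → ℝ → Fin 2 → ℂ := fun n z x =>
    ∑ i, (Complex.exp (-(Complex.I * lam q₀ z * sg j * (ε * (-(n : ℝ) : ℝ)))) * Ymat z b i j)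
      • F n i (kz q₀ z) x with hU
  have hUsol : ∀ n z x, HasDerivAt (U n z) (laxX q₀ z (r x) *ᵥ U n z x) x := by
    intro n z x
    have := HasDerivAt.fun_sum (u := Finset.univ) fun (i : Fin 2) _ =>
      (hF n i (kz q₀ z) x).const_smul
      (Complex.exp (-(Complex.I * lam q₀ z * sg j * (ε * (-(n : ℝ) : ℝ)))) * Ymat z b i j)
    refine this.congr_deriv ?_
    simp only [hU, laxX_eq_matX, Matrix.mulVec_sum, Matrix.mulVec_smul]
  have hUn : ∀ n z, z ≠ 0 → gam q₀ z ≠ 0 → wgt q₀ b ε j z (U n z) (-(n : ℝ)) = Pi.single j 1 := by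
    intro n z hz hγ
    refine wgt_eq_single hz hγ hb ?_
    have h1 : U n z (ε * (-(n : ℝ))) = fun i =>
        Complex.exp (-(Complex.I * lam q₀ z * sg j * (ε * (-(n : ℝ) : ℝ)))) * Ymat z b i j := by
      ext l
      simp only [hU, hFa]
      fin_cases l <;> simp
    rw [h1]
    ext i
    simp only [Pi.smul_apply, smul_eq_mul]
    rw [← mul_assoc, ← Complex.exp_add, add_neg_cancel, Complex.exp_zero, one_mul]
  -- the deviation of `U n z` from the asymptotic form is small towards the end, uniformly in `n`
  have hUdev : ∀ n : ℕ, ∀ z ∈ jostDom q₀ (ε * sg j), ∀ y, -(n : ℝ) ≤ y →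
      nsq (wgt q₀ b ε j z (U n z) y - Pi.single j 1)
        ≤ Real.exp (3 * pertC q₀ z * (devInt r b ε y - J)) - 1 := by
    rintro n z ⟨hz, hγ, hl⟩ y hy
    have h1 := wgt_energy_le hz hγ hb hε hl hr (hUsol n z) zero_le_one hy
    rw [Complex.ofReal_one, hUn n z hz hγ, sub_self] at h1
    have h2 : nsq 0 = 0 := by simp [nsq]
    rw [h2, one_pow, zero_add, one_mul] at h1
    have h3 : Real.exp (3 * pertC q₀ z * (devInt r b ε y - devInt r b ε (-(n : ℝ))))
        ≤ Real.exp (3 * pertC q₀ z * (devInt r b ε y - J)) := by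
      have := pertC_nonneg (q₀ := q₀) (z := z)
      gcongr
      exact hJle _
    linarith
  -- `κ C n` bounds the squared deviation at `-ε n`, carried to the origin by the energy estimate
  set κ : ℝ → ℕ → ℝ := fun C n =>
    (Real.exp (3 * C * (devInt r b ε (-(n : ℝ)) - J)) - 1) * Real.exp (3 * C * (0 - J)) with hκ
  have hκlim : ∀ C, Tendsto (κ C) atTop (𝓝 0) := by
    intro C
    have h1 : Tendsto (fun n : ℕ => devInt r b ε (-(n : ℝ))) atTop (𝓝 J) :=
      hJ.comp (tendsto_neg_atTop_atBot.comp tendsto_natCast_atTop_atTop)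
    have := ((((h1.sub_const J).const_mul (3 * C)).rexp).sub_const 1).mul_const
      (Real.exp (3 * C * (0 - J)))
    simpa [hκ] using this
  have hκmono : ∀ n C C', 0 ≤ C → C ≤ C' → κ C n ≤ κ C' n := by
    intro n C C' hC hCC'
    have h1 : 0 ≤ devInt r b ε (-(n : ℝ)) - J := sub_nonneg.2 (hJle _)
    have h2 : 0 ≤ 0 - J := by linarith
    have h3 : 1 ≤ Real.exp (3 * C * (devInt r b ε (-(n : ℝ)) - J)) :=
      Real.one_le_exp (by positivity)
    have h4 : Real.exp (3 * C * (devInt r b ε (-(n : ℝ)) - J))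
      ≤ Real.exp (3 * C' * (devInt r b ε (-(n : ℝ)) - J)) := by gcongr
    have h5 : Real.exp (3 * C * (0 - J)) ≤ Real.exp (3 * C' * (0 - J)) := by gcongr
    exact mul_le_mul (by linarith) h5 (Real.exp_pos _).le (by linarith)
  set G : ℕ → ℂ → Fin 2 → ℂ := fun n z => U n z 0 with hG
  have hGdist : ∀ z ∈ jostDom q₀ (ε * sg j), ∀ n m : ℕ, n ≤ m →
      dist (G n z) (G m z) ≤ (1 + q₀ / ‖z‖) * Real.sqrt (κ (pertC q₀ z) n) := by
    rintro z hzd n m hnm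
    obtain ⟨hz, hγ, hl⟩ := hzd
    have hdsol : ∀ x, HasDerivAt (fun x => U m z x - U n z x)
        (laxX q₀ z (r x) *ᵥ (U m z x - U n z x)) x := by
      intro x
      rw [Matrix.mulVec_sub]
      exact (hUsol m z x).sub (hUsol n z x)
    have h1 := wgt_energy_le (j := j) hz hγ hb hε hl hr hdsol (le_refl (0 : ℝ))
      (y := -(n : ℝ)) (y' := 0) (by simp)
    simp only [wgt_sub, hUn n z hz hγ, Complex.ofReal_zero, Pi.single_zero, sub_zero, ne_eq,
      OfNat.ofNat_ne_zero, not_false_eq_true, zero_pow, add_zero, devInt_zero] at h1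
    have h2 := hUdev m z ⟨hz, hγ, hl⟩ (-(n : ℝ)) (by simpa using hnm)
    have h3 : Real.exp (3 * pertC q₀ z * (0 - devInt r b ε (-(n : ℝ))))
        ≤ Real.exp (3 * pertC q₀ z * (0 - J)) := by
      have := pertC_nonneg (q₀ := q₀) (z := z)
      gcongr
      exact hJle _
    set d := wgt q₀ b ε j z (U m z) 0 - wgt q₀ b ε j z (U n z) 0 with hd
    have h4 : nsq d ≤ κ (pertC q₀ z) n :=
      h1.trans (mul_le_mul h2 h3 (Real.exp_pos _).le ((nsq_nonneg _).trans h2))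
    have h5 : G m z - G n z = Ymat z b *ᵥ d := by
      rw [hd, ← wgt_sub, Ymat_mulVec_wgt hz hγ hb]
      simp [hG]
    have h6 : ‖d‖ ≤ Real.sqrt (κ (pertC q₀ z) n) :=
      (norm_le_sqrt_nsq d).trans (Real.sqrt_le_sqrt h4)
    rw [dist_comm, dist_eq_norm, h5]
    have hq' : 0 ≤ q₀ / ‖z‖ := by positivity
    refine (pi_norm_le_iff_of_nonneg (by positivity)).2 fun i => ?_
    have hd0 := (norm_le_pi_norm d 0).trans h6
    have hd1 := (norm_le_pi_norm d 1).trans h6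
    fin_cases i
    · simp only [Ymat_eq, Matrix.mulVec, dotProduct, Fin.sum_univ_two]
      simp
      refine (norm_add_le _ _).trans ?_
      rw [norm_neg, norm_mul, norm_div, norm_mul, Complex.norm_I, hb, one_mul, add_mul, one_mul]
      gcongr
    · simp only [Ymat_eq, Matrix.mulVec, dotProduct, Fin.sum_univ_two]
      simp
      refine (norm_add_le _ _).trans ?_
      rw [norm_neg, norm_mul, norm_div, norm_mul, Complex.norm_I, RCLike.norm_conj, hb, one_mul,
        add_mul, one_mul, add_comm]
      gcongr
  have hlim0 : ∀ P C, Tendsto (fun n => P * Real.sqrt (κ C n)) atTop (𝓝 0) := by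
    intro P C
    have := ((Real.continuous_sqrt.tendsto 0).comp (hκlim C)).const_mul P
    simpa using this
  have hex : ∀ z, ∃ g, z ∈ jostDom q₀ (ε * sg j) → Tendsto (fun n => G n z) atTop (𝓝 g) := by
    intro z
    by_cases hz : z ∈ jostDom q₀ (ε * sg j)
    · obtain ⟨g, hg⟩ := cauchySeq_tendsto_of_complete
        (cauchySeq_of_le_tendsto_0' _ (hGdist z hz) (hlim0 _ _))
      exact ⟨g, fun _ => hg⟩
    · exact ⟨0, fun h => absurd h hz⟩
  choose g hg using hex
  have hunif : TendstoLocallyUniformlyOn G g atTop (jostDom q₀ (ε * sg j)) := by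
    rw [Metric.tendstoLocallyUniformlyOn_iff]
    intro δ hδ z₀ hz₀
    have hP : ContinuousAt (fun z : ℂ => 1 + q₀ / ‖z‖) z₀ := by
      have : ‖z₀‖ ≠ 0 := norm_ne_zero_iff.2 hz₀.1
      fun_prop (disch := assumption)
    have e1 : ∀ᶠ z in 𝓝 z₀, pertC q₀ z ≤ pertC q₀ z₀ + 1 :=
      ((continuousAt_pertC hz₀.1 hz₀.2.1).eventually_lt_const (lt_add_one _)).mono fun _ h => h.le
    have e2 : ∀ᶠ z in 𝓝 z₀, 1 + q₀ / ‖z‖ ≤ (1 + q₀ / ‖z₀‖) + 1 :=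
      (hP.eventually_lt_const (lt_add_one _)).mono fun _ h => h.le
    -- near `z₀` the factors are bounded, which makes the rate uniform
    refine ⟨_, inter_mem_nhdsWithin _ (e1.and e2), ?_⟩
    filter_upwards [(hlim0 ((1 + q₀ / ‖z₀‖) + 1) (pertC q₀ z₀ + 1)).eventually_lt_const hδ]
      with n hn z hz
    have h1 : dist (G n z) (g z) ≤ (1 + q₀ / ‖z‖) * Real.sqrt (κ (pertC q₀ z) n) :=
      le_of_tendsto ((tendsto_const_nhds (x := G n z)).dist (hg z hz.1))
        ((eventually_ge_atTop n).mono fun m hm => hGdist z hz.1 n m hm)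
    rw [dist_comm]
    refine (h1.trans ?_).trans_lt hn
    have hq' : 0 ≤ q₀ / ‖z‖ := by positivity
    exact mul_le_mul hz.2.2 (Real.sqrt_le_sqrt (hκmono n _ _ pertC_nonneg hz.2.1))
      (Real.sqrt_nonneg _) (by have : 0 ≤ q₀ / ‖z₀‖ := by positivity
                               linarith)
  have hGd : ∀ n z, z ≠ 0 → DifferentiableAt ℂ (G n) z := by
    intro n z hz
    have hl := differentiableAt_lam (q₀ := q₀) hz
    have hk := differentiableAt_kz (q₀ := q₀) hz
    simp only [hG, hU]
    refine DifferentiableAt.fun_sum fun i _ => ?_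
    have hY := differentiableAt_Ymat (b := b) hz i j
    have hFk : DifferentiableAt ℂ (fun z => F n i (kz q₀ z) 0) z :=
      DifferentiableAt.comp z (hFd n i 0 _) hk
    fun_prop
  refine ⟨g, ?_, ?_, ?_⟩
  · intro z hz u hu hu0
    have hz0 := hz.1
    have hconv : ∀ x, Tendsto (fun m => U m z x) atTop (𝓝 (u x)) := by
      intro x
      obtain ⟨C, hC, hCu⟩ := exists_norm_le_of_linear (continuous_opL_matX hr (kz q₀ z)) 0 x
      rw [tendsto_iff_norm_sub_tendsto_zero]
      have h1 : Tendsto (fun m => C * ‖G m z - g z‖) atTop (𝓝 0) := by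
        simpa using (tendsto_iff_norm_sub_tendsto_zero.1 (hg z hz)).const_mul C
      refine squeeze_zero (fun _ => norm_nonneg _) (fun m => ?_) h1
      have := hCu (fun x => U m z x - u x) fun x => by
        rw [map_sub]
        have e1 := hUsol m z x
        have e2 := hu x
        rw [laxX_eq_matX] at e1 e2
        exact e1.sub e2
      simpa [hu0, hG] using this
    -- the bound for the approximations passes to the limit at each point
    have hdev : ∀ y, nsq (wgt q₀ b ε j z u y - Pi.single j 1)
        ≤ Real.exp (3 * pertC q₀ z * (devInt r b ε y - J)) - 1 := by
      intro y
      have hcont : Tendsto (fun m => nsq (wgt q₀ b ε j z (U m z) y - Pi.single j 1)) atTop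
          (𝓝 (nsq (wgt q₀ b ε j z u y - Pi.single j 1))) := by
        have hc : Continuous nsq := by unfold nsq; fun_prop
        refine (hc.tendsto _).comp (Tendsto.sub_const ?_ _)
        simp only [wgt_eq_mulVec]
        have hc : Continuous fun v : Fin 2 → ℂ => ((gam q₀ z)⁻¹ •
          !![1, Complex.I * b / z; Complex.I * starRingEnd ℂ b / z, 1]) *ᵥ
            (Complex.exp (Complex.I * lam q₀ z * sg j * (ε * y)) • v) := by fun_prop
        exact (hc.tendsto _).comp (hconv (ε * y))
      refine le_of_tendsto hcont ?_
      obtain ⟨N, hN⟩ := exists_nat_ge (-y)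
      filter_upwards [eventually_ge_atTop N] with m hm
      refine hUdev m z hz y ?_
      have : (N : ℝ) ≤ m := by exact_mod_cast hm
      linarith
    have hw : Tendsto (wgt q₀ b ε j z u) atBot (𝓝 (Pi.single j 1)) := by
      rw [tendsto_iff_norm_sub_tendsto_zero]
      have h1 : Tendsto (fun y => Real.sqrt
          (Real.exp (3 * pertC q₀ z * (devInt r b ε y - J)) - 1)) atBot (𝓝 0) := by
        have := (Real.continuous_sqrt.tendsto _).comp
          ((((hJ.sub_const J).const_mul (3 * pertC q₀ z)).rexp).sub_const 1)
        simpa [Function.comp_def] using this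
      exact squeeze_zero (fun _ => norm_nonneg _)
        (fun y => (norm_le_sqrt_nsq _).trans (Real.sqrt_le_sqrt (hdev y))) h1
    have hc : Continuous fun v : Fin 2 → ℂ => Ymat z b *ᵥ v := by fun_prop
    have := (hc.tendsto _).comp hw
    simp only [Function.comp_def, Ymat_mulVec_wgt hz0 hz.2.1 hb] at this
    convert this using 2
    ext i
    simp
  · exact hunif.continuousOn (Frequently.of_forall fun n z hz =>
      (hGd n z hz.1).continuousAt.continuousWithinAt)
  · intro V hV hVs
    exact (hunif.mono hVs).differentiableOn
      (Eventually.of_forall fun n z hz => (hGd n z (hVs hz).1).differentiableWithinAt) hV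

end spatial

/-! ### Time evolution of the Jost columns -/

lemma hasDerivAt_conj {f : ℝ → ℂ} {f' : ℂ} {x : ℝ} (hf : HasDerivAt f f' x) :
    HasDerivAt (fun x => starRingEnd ℂ (f x)) (starRingEnd ℂ f') x :=
  Complex.conjCLE.toContinuousLinearMap.hasFDerivAt.comp_hasDerivAt x hf

/-- If the partial derivative is jointly continuous, then the first-order Taylor remainder is small
uniformly for the second variable in a compact interval. -/
lemma eventually_norm_sub_sub_le {V : Type*} [NormedAddCommGroup V] [NormedSpace ℝ V]
    {F F' : ℝ → ℝ → V} (hF : ∀ x t, HasDerivAt (fun y => F y t) (F' x t) x)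
    (hF' : Continuous fun p : ℝ × ℝ => F' p.1 p.2) (x₀ a N : ℝ) {c : ℝ} (hc : 0 < c) :
    ∀ᶠ x in 𝓝 x₀, ∀ t, |t - a| ≤ N →
      ‖F x t - F x₀ t - (x - x₀) • F' x₀ t‖ ≤ c * ‖x - x₀‖ := by
  have h1 : ∀ᶠ x in 𝓝 x₀, ∀ t ∈ Metric.closedBall a N, ‖F' x t - F' x₀ t‖ < c := by
    refine (isCompact_closedBall a N).eventually_forall_of_forall_eventually fun t _ => ?_
    have hcont : Continuous fun p : ℝ × ℝ => ‖F' p.1 p.2 - F' x₀ p.2‖ :=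
      (hF'.sub (hF'.comp (continuous_const.prodMk continuous_snd))).norm
    exact (hcont.tendsto (x₀, t)).eventually_lt_const (by simpa using hc)
  obtain ⟨δ, hδ, hball⟩ := Metric.eventually_nhds_iff_ball.1 h1
  filter_upwards [Metric.ball_mem_nhds x₀ hδ] with x hx t ht
  have := (convex_ball x₀ δ).norm_image_sub_le_of_norm_hasDerivWithin_le
    (f := fun y => F y t - (y - x₀) • F' x₀ t) (f' := fun y => F' y t - F' x₀ t) (C := c)
    (x := x₀) (y := x)
    (fun y _ => by
      have h := (hF y t).sub (((hasDerivAt_id y).sub_const x₀).smul_const (F' x₀ t))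
      simp only [one_smul] at h
      exact h.hasDerivWithinAt)
    (fun y hy => (hball y hy t (by simpa [Real.dist_eq] using ht)).le)
    (Metric.mem_ball_self hδ) hx
  simp only [sub_self, zero_smul, sub_zero] at this
  rwa [sub_right_comm] at this

/-- The derivative of the matrix `T` in `x`, in terms of `q`, `qₓ` and `qₓₓ`. -/
def matTx (q₀ : ℝ) (z w wx wxx : ℂ) : Matrix (Fin 2) (Fin 2) ℂ :=
  !![Complex.I / 2 * (wx * starRingEnd ℂ w + w * starRingEnd ℂ wx),
      kz q₀ z * wx + Complex.I / 2 * wxx;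
    -(kz q₀ z * starRingEnd ℂ wx) + Complex.I / 2 * starRingEnd ℂ wxx,
      -(Complex.I / 2 * (wx * starRingEnd ℂ w + w * starRingEnd ℂ wx))]

lemma continuous_opL_laxT (q₀ : ℝ) (z : ℂ) {α : Type*} [TopologicalSpace α] {w wx : α → ℂ}
    (hw : Continuous w) (hwx : Continuous wx) :
    Continuous fun p => opL (laxT q₀ z (w p) (wx p)) := by
  refine opL.continuous.comp (continuous_pi fun i => continuous_pi fun j => ?_)
  have h1 : Continuous fun p => starRingEnd ℂ (w p) := Complex.continuous_conj.comp hw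
  have h2 : Continuous fun p => starRingEnd ℂ (wx p) := Complex.continuous_conj.comp hwx
  simp only [laxT_eq]
  fin_cases i <;> fin_cases j <;> simp <;> fun_prop

lemma continuous_opL_matTx (q₀ : ℝ) (z : ℂ) {α : Type*} [TopologicalSpace α] {w wx wxx : α → ℂ}
    (hw : Continuous w) (hwx : Continuous wx) (hwxx : Continuous wxx) :
    Continuous fun p => opL (matTx q₀ z (w p) (wx p) (wxx p)) := by
  refine opL.continuous.comp (continuous_pi fun i => continuous_pi fun j => ?_)
  have h1 : Continuous fun p => starRingEnd ℂ (w p) := Complex.continuous_conj.comp hw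
  have h2 : Continuous fun p => starRingEnd ℂ (wx p) := Complex.continuous_conj.comp hwx
  have h3 : Continuous fun p => starRingEnd ℂ (wxx p) := Complex.continuous_conj.comp hwxx
  simp only [matTx]
  fin_cases i <;> fin_cases j <;> simp <;> fun_prop

section Lax

variable {q₀ : ℝ} {q : ℝ → ℝ → ℂ}

lemma IsClassicalSolution.hasDerivAt_x (hq : IsClassicalSolution q₀ q) (x t : ℝ) :
    HasDerivAt (fun y => q y t) (dx q x t) x :=
  ((hq.contDiff_x t).differentiable (by norm_num) x).hasDerivAt

lemma IsClassicalSolution.hasDerivAt_xx (hq : IsClassicalSolution q₀ q) (x t : ℝ) :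
    HasDerivAt (fun y => dx q y t) (dx (dx q) x t) x := by
  have h : ContDiff ℝ 1 (deriv fun x => q x t) := ((contDiff_succ_iff_deriv (n := 1)).1 (by
    simpa using! hq.contDiff_x t)).2.2
  exact (h.differentiable (by norm_num) x).hasDerivAt

lemma IsClassicalSolution.hasDerivAt_t (hq : IsClassicalSolution q₀ q) (x t : ℝ) :
    HasDerivAt (fun s => q x s)
      (Complex.I * (dx (dx q) x t / 2 + (q x t * starRingEnd ℂ (q x t) - q₀ ^ 2) * q x t)) t := by
  refine (hq.differentiable_t x t).hasDerivAt.congr_deriv ?_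
  have h := hq.equation x t
  have hn : (((‖q x t‖ ^ 2 - q₀ ^ 2 : ℝ)) : ℂ) = q x t * starRingEnd ℂ (q x t) - q₀ ^ 2 := by
    rw [mul_conj_of_norm rfl]
    push_cast
    rfl
  rw [hn] at h
  have hI := Complex.I_sq
  change dt q x t = _
  linear_combination (-Complex.I) * h + dt q x t * hI

lemma IsClassicalSolution.hasDerivAt_laxT (hq : IsClassicalSolution q₀ q) (z : ℂ) (x t : ℝ) :
    HasDerivAt (fun y => opL (laxT q₀ z (q y t) (dx q y t)))
      (opL (matTx q₀ z (q x t) (dx q x t) (dx (dx q) x t))) x := by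
  suffices h : HasDerivAt (fun y i j => laxT q₀ z (q y t) (dx q y t) i j)
      (fun i j => matTx q₀ z (q x t) (dx q x t) (dx (dx q) x t) i j) x from
    (opL.restrictScalars ℝ).hasFDerivAt.comp_hasDerivAt x h
  have h1 := hq.hasDerivAt_x x t
  have h2 := hq.hasDerivAt_xx x t
  have h1c := hasDerivAt_conj h1
  have h2c := hasDerivAt_conj h2
  refine hasDerivAt_pi.2 fun i => hasDerivAt_pi.2 fun j => ?_
  simp only [laxT_eq, matTx]
  fin_cases i <;> fin_cases j <;> simp
  · refine ((((h1.mul h1c).const_sub ((q₀ : ℂ) ^ 2)).const_mul (Complex.I / 2)).const_sub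
      (-(Complex.I * kz q₀ z ^ 2))).congr_deriv ?_
    ring
  · exact (h1.const_mul (kz q₀ z)).add (h2.const_mul (Complex.I / 2))
  · exact (h1c.const_mul (kz q₀ z)).neg.add (h2c.const_mul (Complex.I / 2))
  · refine (((h1.mul h1c).const_sub ((q₀ : ℂ) ^ 2)).const_mul (Complex.I / 2)).congr_deriv ?_
    ring

/-- The compatibility of the two equations of the Lax pair: along a solution `φ` of the temporal
equation, `X φ` solves the temporal equation linearized in `x`. This is the zero curvature condition
`X_t + X T = T_x + T X`, which is the nonlinear Schrödinger equation. -/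
lemma IsClassicalSolution.hasDerivAt_laxX_mulVec (hq : IsClassicalSolution q₀ q) (z : ℂ) (x t : ℝ)
    {φ : ℝ → Fin 2 → ℂ} (hφ : HasDerivAt φ (laxT q₀ z (q x t) (dx q x t) *ᵥ φ t) t) :
    HasDerivAt (fun s => laxX q₀ z (q x s) *ᵥ φ s)
      (laxT q₀ z (q x t) (dx q x t) *ᵥ (laxX q₀ z (q x t) *ᵥ φ t)
        + matTx q₀ z (q x t) (dx q x t) (dx (dx q) x t) *ᵥ φ t) t := by
  have ht := hq.hasDerivAt_t x t
  have htc := hasDerivAt_conj ht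
  simp only [map_mul, map_add, map_sub, Complex.conj_I, map_div₀, map_pow, Complex.conj_ofReal,
    Complex.conj_conj, map_ofNat] at htc
  have hφ0 := hasDerivAt_pi.1 hφ 0
  have hφ1 := hasDerivAt_pi.1 hφ 1
  refine hasDerivAt_pi.2 fun i => ?_
  simp only [laxX_eq, laxT_eq, matTx, Matrix.mulVec, dotProduct, Fin.sum_univ_two, Pi.add_apply,
    Matrix.of_apply, Matrix.cons_val', Matrix.cons_val_zero, Matrix.cons_val_one,
    Matrix.cons_val_fin_one] at hφ0 hφ1 ⊢
  fin_cases i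
  · refine ((hφ0.const_mul (-(Complex.I * kz q₀ z))).add (ht.mul hφ1)).congr_deriv ?_
    simp
    ring_nf
    simp only [Complex.I_sq]
    ring_nf
  · refine ((htc.neg.mul hφ0).add (hφ1.const_mul (Complex.I * kz q₀ z))).congr_deriv ?_
    simp
    ring_nf
    simp only [Complex.I_sq]
    ring_nf

/-- The asymptotic eigenvectors are eigenvectors of the temporal matrix at the boundary value. -/
lemma laxT_mulVec_Ymat {b z : ℂ} (hz : z ≠ 0) (hb : ‖b‖ = q₀) (j : Fin 2) :
    (laxT q₀ z b 0 *ᵥ fun i => Ymat z b i j)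
      + (Complex.I * lam q₀ z * kz q₀ z * sg j) • (fun i => Ymat z b i j) = 0 := by
  have hbb := mul_conj_of_norm hb
  ext i
  fin_cases i <;> fin_cases j <;>
    simp [laxT_eq, Ymat_eq, Matrix.mulVec, dotProduct, sg, lam, kz, ← hbb] <;>
    field_simp <;> ring_nf <;> simp only [Complex.I_sq] <;> ring_nf

/-- A solution of the spatial equation at time `0` with the asymptotics of a Jost column extends to
a Jost column. The temporal equation, solved at each `x` from time `0`, preserves the spatial
equation by the zero curvature condition, and it preserves the asymptotics because its coefficients
converge locally uniformly in time. -/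
theorem exists_isJostColumn (hq : IsClassicalSolution q₀ q) {b : ℂ} (hb : ‖b‖ = q₀) {l : Filter ℝ}
    (hbv : HasBoundaryValue q b l) {z : ℂ} (hz : z ≠ 0) {j : Fin 2} {φ : ℝ → Fin 2 → ℂ}
    (hφ : ∀ x, HasDerivAt φ (laxX q₀ z (q x 0) *ᵥ φ x) x)
    (hφl : Tendsto (fun x => Complex.exp (Complex.I * theta q₀ x 0 z * sg j) • φ x) l
      (𝓝 fun i => Ymat z b i j)) :
    ∃ ψ, IsJostColumn q₀ q b l j z ψ ∧ ∀ x, ψ x 0 = φ x := by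
  have hcont : ∀ x, Continuous fun t => opL (laxT q₀ z (q x t) (dx q x t)) := fun x =>
    continuous_opL_laxT q₀ z (hq.continuous_q.comp (Continuous.prodMk_right x))
      (hq.continuous_dx.comp (Continuous.prodMk_right x))
  choose Φ hΦ0 hΦ using fun x => exists_hasDerivAt_linear _ (hcont x) 0 (φ x)
  have hTx : Continuous fun p : ℝ × ℝ =>
      opL (matTx q₀ z (q p.1 p.2) (dx q p.1 p.2) (dx (dx q) p.1 p.2)) :=
    continuous_opL_matTx q₀ z hq.continuous_q hq.continuous_dx hq.continuous_dxx
  refine ⟨Φ, ⟨fun x t => ?_, hΦ, fun t => ?_⟩, hΦ0⟩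
  -- the parameter is `x`, and the candidate for the derivative is `X Φ`
  · refine hasDerivAt_param_of_linear (fun x t => opL (laxT q₀ z (q x t) (dx q x t)))
      (fun t => opL (matTx q₀ z (q x t) (dx q x t) (dx (dx q) x t))) Φ
      (fun t => laxX q₀ z (q x t) *ᵥ Φ x t) x 0 (hcont x)
      (continuous_opL_matTx q₀ z (hq.continuous_q.comp (Continuous.prodMk_right x))
        (hq.continuous_dx.comp (Continuous.prodMk_right x))
        (hq.continuous_dxx.comp (Continuous.prodMk_right x))) ?_ hΦ
      (fun s => hq.hasDerivAt_laxX_mulVec z x s (hΦ x s)) ?_ t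
    · intro N c hc
      filter_upwards [eventually_norm_sub_sub_le
        (F := fun x t => opL (laxT q₀ z (q x t) (dx q x t)))
        (F' := fun x t => opL (matTx q₀ z (q x t) (dx q x t) (dx (dx q) x t)))
        (fun x t => hq.hasDerivAt_laxT z x t) hTx x 0 N hc] with p hp s hs v
      exact ContinuousLinearMap.le_of_opNorm_le _ (hp s hs) v
    · simp only [hΦ0]
      exact hφ x
  · rw [sigma3_diag]
    set Y : Fin 2 → ℂ := fun i => Ymat z b i j with hY
    set A₀ := opL (laxT q₀ z b 0) with hA₀
    set ν : ℂ := Complex.I * lam q₀ z * kz q₀ z * sg j with hν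
    set N := |t| with hN
    set X := Real.exp ((‖A₀‖ + 1 + ‖ν‖ + 1) * N) with hX
    have hXpos : 0 < X := Real.exp_pos _
    rw [Metric.tendsto_nhds] at hφl ⊢
    intro η hη
    -- `δ` makes the contribution of the inhomogeneity to the Grönwall bound at most `η / 2`
    set δ := min 1 (η / (2 * X * (‖Y‖ + 1))) with hδ
    have hδpos : 0 < δ := lt_min one_pos (by positivity)
    have hδ1 : δ ≤ 1 := min_le_left _ _
    have hδ2 : δ * (2 * X * (‖Y‖ + 1)) ≤ η := by
      rw [← le_div_iff₀ (by positivity)]; exact min_le_right _ _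
    have hclose : ∀ᶠ x in l, ∀ s, |s - 0| ≤ N →
        ‖opL (laxT q₀ z (q x s) (dx q x s)) - A₀‖ ≤ δ := by
      obtain ⟨ρ, hρ, hρball⟩ := Metric.continuous_iff.1 (continuous_opL_laxT q₀ z (α := ℂ × ℂ)
        continuous_fst continuous_snd) (b, 0) δ hδpos
      have hK := isCompact_closedBall (0 : ℝ) N
      have e1 := Metric.tendstoUniformlyOn_iff.1
        (tendstoLocallyUniformly_iff_forall_isCompact.1 hbv.tendsto_q _ hK) ρ hρ
      have e2 := Metric.tendstoUniformlyOn_iff.1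
        (tendstoLocallyUniformly_iff_forall_isCompact.1 hbv.tendsto_dx _ hK) ρ hρ
      filter_upwards [e1, e2] with x h1 h2 s hs
      have hs' : s ∈ Metric.closedBall (0 : ℝ) N := by simpa [Real.dist_eq] using hs
      have := hρball (q x s, dx q x s) (by
        rw [Prod.dist_eq, max_lt_iff, dist_comm, dist_comm (dx q x s)]
        exact ⟨h1 s hs', h2 s hs'⟩)
      rw [dist_eq_norm] at this
      exact this.le
    filter_upwards [hclose, hφl (η / (2 * X)) (by positivity)] with x hx hx0
    have hexp : ∀ s : ℝ, HasDerivAt (fun s : ℝ => Complex.exp (Complex.I * theta q₀ x s z * sg j))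
        (ν * Complex.exp (Complex.I * theta q₀ x s z * sg j)) s := by
      intro s
      have h1 : HasDerivAt (fun s : ℝ => Complex.I * theta q₀ x s z * sg j) ν s := by
        have := (((((hasDerivAt_id s).ofReal_comp.const_mul (kz q₀ z)).const_add (x : ℂ)).const_mul
          (lam q₀ z)).const_mul Complex.I).mul_const (sg j : ℂ)
        refine this.congr_deriv ?_
        rw [hν]
        push_cast
        ring
      exact h1.cexp.congr_deriv (mul_comm _ _)
    have hd : ∀ s, HasDerivAt (fun s => Complex.exp (Complex.I * theta q₀ x s z * sg j) • Φ x s - Y)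
        (opL (laxT q₀ z (q x s) (dx q x s))
            (Complex.exp (Complex.I * theta q₀ x s z * sg j) • Φ x s - Y)
          + ν • (Complex.exp (Complex.I * theta q₀ x s z * sg j) • Φ x s - Y)
          + (opL (laxT q₀ z (q x s) (dx q x s)) - A₀) Y) s := by
      intro s
      refine (((hexp s).smul (hΦ x s)).sub_const Y).congr_deriv ?_
      have h0 : A₀ Y + ν • Y = 0 := laxT_mulVec_Ymat hz hb j
      have h0' : A₀ Y = -(ν • Y) := eq_neg_of_add_eq_zero_left h0
      rw [map_sub, map_smul, _root_.sub_apply, h0', smul_sub, mul_smul]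
      abel
    have hfin := norm_le_of_norm_deriv_le (a := 0) (K := ‖A₀‖ + 1 + ‖ν‖) (ε := δ * ‖Y‖) (N := N)
      (by positivity) (by positivity) hd (fun s hs => ?_) (s := t) (by simp [hN])
    · rw [dist_eq_norm]
      simp only [hΦ0] at hfin
      rw [dist_eq_norm] at hx0
      refine hfin.trans_lt ?_
      have h1 : ‖Complex.exp (Complex.I * theta q₀ x 0 z * sg j) • φ x - Y‖ * X < η / 2 := by
        have := mul_lt_mul_of_pos_right hx0 hXpos
        have e : η / (2 * X) * X = η / 2 := by field_simp
        rwa [e] at this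
      have h2 : δ * ‖Y‖ * X ≤ η / 2 := by
        have : 0 ≤ δ * X := by positivity
        nlinarith
      rw [← hX]
      linarith
    · refine norm_add₃_le.trans ?_
      have h1 : ‖opL (laxT q₀ z (q x s) (dx q x s))‖ ≤ ‖A₀‖ + 1 := by
        have := norm_le_norm_add_norm_sub' (opL (laxT q₀ z (q x s) (dx q x s))) A₀
        linarith [hx s hs]
      have h2 := ContinuousLinearMap.le_of_opNorm_le _ h1
        (Complex.exp (Complex.I * theta q₀ x s z * sg j) • Φ x s - Y)
      have h3 := ContinuousLinearMap.le_of_opNorm_le _ (hx s hs) Y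
      rw [norm_smul]
      linarith

/-- Existence and uniqueness of a Jost column at all points of its domain, and the regularity in `z`
of its value at the origin. -/
theorem jostColumn_existsUnique_and_regular (hq : IsClassicalSolution q₀ q) {b : ℂ} (hb : ‖b‖ = q₀)
    {l : Filter ℝ} [l.NeBot] (hbv : HasBoundaryValue q b l) {ε : ℝ} (hε : |ε| = 1)
    (hl : Tendsto (fun x => ε * x) l atBot) (hl' : Tendsto (fun y => ε * y) atBot l)
    (hL : ∀ t, IntegrableOn (fun y => q (ε * y) t - b) (Set.Iic 0)) (j : Fin 2) :
    (∀ z ∈ jostDom q₀ (ε * sg j), ∃! ψ, IsJostColumn q₀ q b l j z ψ) ∧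
    ∃ g : ℂ → Fin 2 → ℂ, ContinuousOn g (jostDom q₀ (ε * sg j)) ∧
      (∀ U, IsOpen U → U ⊆ jostDom q₀ (ε * sg j) → DifferentiableOn ℂ g U) ∧
      ∀ z ∈ jostDom q₀ (ε * sg j), ∀ ψ, IsJostColumn q₀ q b l j z ψ → ψ 0 0 = g z := by
  have hε2 : ε * ε = 1 := by rw [← abs_mul_abs_self, hε, one_mul]
  have hr : ∀ t, Continuous fun x => q x t := fun t => (hq.contDiff_x t).continuous
  choose J hJ using fun t => exists_tendsto_devInt (r := fun x => q x t) (hL t)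
  obtain ⟨g, hg, hgc, hgd⟩ := exists_jost_initial (j := j) hb hε (hr 0) (hJ 0)
  -- the difference of two Jost columns decays in its weighted form
  have huniq : ∀ z ∈ jostDom q₀ (ε * sg j), ∀ ψ₁ ψ₂, IsJostColumn q₀ q b l j z ψ₁ →
      IsJostColumn q₀ q b l j z ψ₂ → ψ₁ = ψ₂ := by
    rintro z ⟨hz, hγ, him⟩ ψ₁ ψ₂ h₁ h₂
    ext1 x
    ext1 t
    refine sub_eq_zero.1 (eq_zero_of_tendsto (j := j) hz hγ hb hε him (hr t) (hJ t)
      (u := fun x => ψ₁ x t - ψ₂ x t) (fun x => ?_) ?_ x)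
    · rw [Matrix.mulVec_sub]
      exact (h₁.x_equation x t).sub (h₂.x_equation x t)
    · have h := (((h₁.asymptotics t).sub (h₂.asymptotics t)).comp hl').const_smul
        (Complex.exp (-(Complex.I * lam q₀ z * sg j * kz q₀ z * t)))
      rw [sub_self, smul_zero] at h
      refine h.congr fun y => ?_
      simp only [Function.comp_apply]
      rw [← smul_sub, smul_smul, ← Complex.exp_add, sigma3_diag, theta]
      congr 2
      push_cast
      ring
  have hex : ∀ z ∈ jostDom q₀ (ε * sg j), ∃ ψ, IsJostColumn q₀ q b l j z ψ ∧ ψ 0 0 = g z := by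
    intro z hz
    obtain ⟨u, hu0, hu⟩ := exists_hasDerivAt_linear _ (continuous_opL_matX (hr 0) (kz q₀ z)) 0 (g z)
    have hu : ∀ x, HasDerivAt u (laxX q₀ z (q x 0) *ᵥ u x) x := fun x => by
      rw [laxX_eq_matX]
      exact hu x
    obtain ⟨ψ, hψ, hψ0⟩ := exists_isJostColumn hq hb hbv hz.1 (j := j) hu (by
      refine ((hg z hz u hu hu0).comp hl).congr fun x => ?_
      have hx : ε * (ε * x) = x := by rw [← mul_assoc, hε2, one_mul]
      have hx' : (ε : ℂ) * ((ε * x : ℝ) : ℂ) = x := by rw [← Complex.ofReal_mul, hx]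
      simp only [Function.comp_apply, hx, hx', theta]
      congr 2
      push_cast
      ring)
    exact ⟨ψ, hψ, by rw [hψ0, hu0]⟩
  refine ⟨fun z hz => ?_, g, hgc, hgd, fun z hz ψ hψ => ?_⟩
  · obtain ⟨ψ, hψ, -⟩ := hex z hz
    exact ⟨ψ, hψ, fun ψ' hψ' => huniq z hz _ _ hψ' hψ⟩
  · obtain ⟨ψ', hψ', h0⟩ := hex z hz
    rw [huniq z hz _ _ hψ hψ', h0]

/-! ### Wronskians and the scattering matrix -/

lemma Wr_eq (v w : Fin 2 → ℂ) : Wr v w = v 0 * w 1 - w 0 * v 1 := by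
  simp [Wr, ofCols, Matrix.det_fin_two_of]

lemma Wr_smul_smul (a c : ℂ) (v w : Fin 2 → ℂ) : Wr (a • v) (c • w) = a * c * Wr v w := by
  simp only [Wr_eq, Pi.smul_apply, smul_eq_mul]
  ring

lemma continuous_Wr : Continuous fun p : (Fin 2 → ℂ) × (Fin 2 → ℂ) => Wr p.1 p.2 := by
  simp only [Wr_eq]
  fun_prop

/-- Abel's identity for a trace-free system. -/
lemma Wr_const {M : ℝ → Matrix (Fin 2) (Fin 2) ℂ} (hM : ∀ s, M s 0 0 + M s 1 1 = 0)
    {v w : ℝ → Fin 2 → ℂ} (hv : ∀ s, HasDerivAt v (M s *ᵥ v s) s)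
    (hw : ∀ s, HasDerivAt w (M s *ᵥ w s) s) (s s' : ℝ) : Wr (v s) (w s) = Wr (v s') (w s') := by
  have hd : ∀ s, HasDerivAt (fun s => Wr (v s) (w s)) 0 s := by
    intro s
    have hv' := hasDerivAt_pi.1 (hv s)
    have hw' := hasDerivAt_pi.1 (hw s)
    simp only [Wr_eq]
    refine (((hv' 0).mul (hw' 1)).sub ((hw' 0).mul (hv' 1))).congr_deriv ?_
    simp only [Matrix.mulVec, dotProduct, Fin.sum_univ_two]
    linear_combination (v s 0 * w s 1 - w s 0 * v s 1) * hM s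
  exact is_const_of_deriv_eq_zero (fun s => (hd s).differentiableAt) (fun s => (hd s).deriv) s s'

lemma IsJostColumn.Wr_const {b b' : ℂ} {l l' : Filter ℝ} {j j' : Fin 2} {z : ℂ}
    {v w : ℝ → ℝ → Fin 2 → ℂ} (hv : IsJostColumn q₀ q b l j z v)
    (hw : IsJostColumn q₀ q b' l' j' z w) (x t x' t' : ℝ) :
    Wr (v x t) (w x t) = Wr (v x' t') (w x' t') := by
  have h1 := NZBC.Wr_const (M := fun y => laxX q₀ z (q y t)) (by simp [laxX_eq])
    (fun y => hv.x_equation y t) (fun y => hw.x_equation y t) x x'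
  have h2 := NZBC.Wr_const (M := fun s => laxT q₀ z (q x' s) (dx q x' s)) (by simp [laxT_eq])
    (fun s => hv.t_equation x' s) (fun s => hw.t_equation x' s) t t'
  exact h1.trans h2

/-- The Wronskian of the two Jost columns at one end is `γ`: it is constant, and equal to the
determinant of the asymptotic eigenvectors in the limit. -/
lemma IsJostColumn.Wr_eq_gam {b : ℂ} (hb : ‖b‖ = q₀) {l : Filter ℝ} [l.NeBot] {z : ℂ}
    {v w : ℝ → ℝ → Fin 2 → ℂ} (hv : IsJostColumn q₀ q b l 0 z v)
    (hw : IsJostColumn q₀ q b l 1 z w) (x t : ℝ) : Wr (v x t) (w x t) = gam q₀ z := by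
  have hlim := (continuous_Wr.tendsto _).comp ((hv.asymptotics t).prodMk_nhds (hw.asymptotics t))
  have hconst : ∀ y, Wr (Complex.exp (Complex.I * theta q₀ y t z * sigma3 0 0) • v y t)
      (Complex.exp (Complex.I * theta q₀ y t z * sigma3 1 1) • w y t) = Wr (v x t) (w x t) := by
    intro y
    rw [Wr_smul_smul, ← Complex.exp_add, hv.Wr_const hw y t x t]
    simp [sigma3]
  simp only [Function.comp_def, hconst] at hlim
  rw [tendsto_nhds_unique tendsto_const_nhds hlim, Wr_eq]
  simp only [Ymat_eq, gam, ← mul_conj_of_norm hb]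
  simp
  linear_combination (-(b * starRingEnd ℂ b / z ^ 2)) * Complex.I_sq

end Lax

/-- The matrix of quotients of Wronskians by `g` that expresses `(v', w')` through `(v, w)` if
`g = Wr(v, w)`. With the Jost columns and `γ` it is the scattering matrix, and each of its entries
makes sense as soon as the two columns in it do. -/
def scatMatrix (g : ℂ) (v w v' w' : Fin 2 → ℂ) : Matrix (Fin 2) (Fin 2) ℂ :=
  !![Wr v' w / g, Wr w' w / g; Wr v v' / g, Wr v w' / g]

/-- Cramer's rule. -/
lemma ofCols_eq_mul (v w v' w' : Fin 2 → ℂ) {g : ℂ} (hg : g ≠ 0) (h : Wr v w = g) :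
    ofCols v' w' = ofCols v w * scatMatrix g v w v' w' := by
  subst h
  ext i j
  fin_cases i <;> fin_cases j <;>
    simp [ofCols, scatMatrix, Matrix.mul_apply, Fin.sum_univ_two] <;>
    field_simp <;> simp only [Wr_eq] <;> ring

/-! ### The uniformization plane -/

lemma lam_im_mul (q₀ : ℝ) {z : ℂ} (hz : z ≠ 0) :
    2 * ‖z‖ ^ 2 * (lam q₀ z).im = (‖z‖ ^ 2 - q₀ ^ 2) * z.im := by
  have hn : Complex.normSq z ≠ 0 := (Complex.normSq_pos.2 hz).ne'
  have h : (lam q₀ z).im = (z.im - q₀ ^ 2 * z.im / Complex.normSq z) / 2 := by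
    have : lam q₀ z = ((1 / 2 : ℝ) : ℂ) * (z + ((q₀ ^ 2 : ℝ) : ℂ) * z⁻¹) := by
      rw [lam]
      push_cast
      ring
    rw [this, Complex.im_ofReal_mul, Complex.add_im, Complex.im_ofReal_mul, Complex.inv_im]
    ring
  rw [h, ← Complex.normSq_eq_norm_sq]
  field_simp

lemma gam_eq_zero_iff {q₀ : ℝ} {z : ℂ} (hz : z ≠ 0) :
    gam q₀ z = 0 ↔ z = Complex.I * q₀ ∨ z = -(Complex.I * q₀) := by
  have h : gam q₀ z = (z - Complex.I * q₀) * (z + Complex.I * q₀) / z ^ 2 := by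
    rw [gam]
    field_simp
    linear_combination (q₀ : ℂ) ^ 2 * Complex.I_sq
  rw [h, div_eq_zero_iff, mul_eq_zero, sub_eq_zero, add_eq_zero_iff_eq_neg]
  simp [hz]

/-- The domains of the Jost columns in terms of `|z|` and `Im z`; the branch points `± i q₀` are the
zeros of `γ`. -/
lemma mem_jostDom_iff {q₀ : ℝ} (hq₀ : 0 < q₀) {τ : ℝ} (hτ : τ ≠ 0) {z : ℂ} :
    z ∈ jostDom q₀ τ ↔ 0 < τ * ((‖z‖ ^ 2 - q₀ ^ 2) * z.im) ∨ z ∈ Sig0 q₀ := by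
  have hbranch : ‖Complex.I * (q₀ : ℂ)‖ = q₀ := by simp [hq₀.le]
  constructor
  · rintro ⟨hz, hγ, h⟩
    rw [or_iff_not_imp_left]
    intro hneg
    rw [← lam_im_mul q₀ hz] at hneg
    have hz' : 0 < ‖z‖ := norm_pos_iff.2 hz
    have him : (lam q₀ z).im = 0 := by
      by_contra hne
      refine hneg ?_
      have : 0 < τ * (lam q₀ z).im := lt_of_le_of_ne h (mul_ne_zero hτ hne).symm
      have : 0 < 2 * ‖z‖ ^ 2 * (τ * (lam q₀ z).im) := by positivity
      linarith
    have h0 := lam_im_mul q₀ hz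
    rw [him, mul_zero, eq_comm, mul_eq_zero, sub_eq_zero] at h0
    refine ⟨⟨hz, ?_⟩, ?_⟩
    · rcases h0 with h0 | h0
      · exact Or.inr ((sq_eq_sq₀ (norm_nonneg z) hq₀.le).1 h0)
      · exact Or.inl h0
    · rw [Ne, gam_eq_zero_iff hz] at hγ
      simpa using hγ
  · intro h
    have hz : z ≠ 0 := by
      rcases h with h | h
      · rintro rfl
        simp at h
      · exact h.1.1
    have hz' : 0 < ‖z‖ := norm_pos_iff.2 hz
    refine ⟨hz, ?_, ?_⟩
    · rw [Ne, gam_eq_zero_iff hz]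
      intro hcases
      rcases h with h | h
      · have : ‖z‖ = q₀ := by
          rcases hcases with rfl | rfl
          · exact hbranch
          · rw [norm_neg, hbranch]
        rw [this] at h
        simp at h
      · exact h.2 (by simpa using hcases)
    · have hpos : 0 ≤ τ * ((‖z‖ ^ 2 - q₀ ^ 2) * z.im) := by
        rcases h with h | h
        · exact h.le
        · rcases h.1.2 with h0 | h0 <;> simp [h0]
      rw [← lam_im_mul q₀ hz] at hpos
      have h2 : 0 < 2 * ‖z‖ ^ 2 := by positivity
      by_contra hlt
      have := mul_neg_of_pos_of_neg h2 (not_le.1 hlt)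
      linarith

lemma jostDom_one {q₀ : ℝ} (hq₀ : 0 < q₀) : jostDom q₀ 1 = Dplus q₀ ∪ Sig0 q₀ := by
  ext z
  rw [mem_jostDom_iff hq₀ one_ne_zero, one_mul]
  rfl

lemma jostDom_neg_one {q₀ : ℝ} (hq₀ : 0 < q₀) : jostDom q₀ (-1) = Dminus q₀ ∪ Sig0 q₀ := by
  ext z
  rw [mem_jostDom_iff hq₀ (by norm_num), neg_one_mul, Left.neg_pos_iff]
  rfl

lemma isOpen_Dplus (q₀ : ℝ) : IsOpen (Dplus q₀) :=
  isOpen_lt (by fun_prop) (by fun_prop)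

lemma isOpen_Dminus (q₀ : ℝ) : IsOpen (Dminus q₀) :=
  isOpen_lt (by fun_prop) (by fun_prop)

lemma continuousOn_Wr_div {q₀ : ℝ} {s : Set ℂ} (hs : ∀ z ∈ s, z ≠ 0 ∧ gam q₀ z ≠ 0)
    {f g : ℂ → Fin 2 → ℂ} (hf : ContinuousOn f s) (hg : ContinuousOn g s) :
    ContinuousOn (fun z => Wr (f z) (g z) / gam q₀ z) s :=
  (continuous_Wr.comp_continuousOn (hf.prodMk hg)).div
    (fun z hz => (differentiableAt_gam (hs z hz).1).continuousAt.continuousWithinAt)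
    fun z hz => (hs z hz).2

lemma differentiableOn_Wr_div {q₀ : ℝ} {s : Set ℂ} (hs : ∀ z ∈ s, z ≠ 0 ∧ gam q₀ z ≠ 0)
    {f g : ℂ → Fin 2 → ℂ} (hf : DifferentiableOn ℂ f s) (hg : DifferentiableOn ℂ g s) :
    DifferentiableOn ℂ (fun z => Wr (f z) (g z) / gam q₀ z) s := by
  have hf' := differentiableOn_pi.1 hf
  have hg' := differentiableOn_pi.1 hg
  refine DifferentiableOn.div ?_
    (fun z hz => (differentiableAt_gam (hs z hz).1).differentiableWithinAt) fun z hz => (hs z hz).2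
  simp only [Wr_eq]
  exact ((hf' 0).mul (hg' 1)).sub ((hg' 0).mul (hf' 1))

end NZBC

end

theorem mainTheorem2 (q₀ : ℝ) (hq₀ : 0 < q₀) (q : ℝ → ℝ → ℂ) (qm qp : ℂ)
    (hqm : ‖qm‖ = q₀) (hqp : ‖qp‖ = q₀)
    (hq : NZBC.IsClassicalSolution q₀ q)
    (hbm : NZBC.HasBoundaryValue q qm atBot) (hbp : NZBC.HasBoundaryValue q qp atTop)
    (hLm : ∀ t, IntegrableOn (fun x => q x t - qm) (Set.Iic 0))
    (hLp : ∀ t, IntegrableOn (fun x => q x t - qp) (Set.Ici 0)) :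
    -- the columns of the Jost solutions exist and are unique
    (∀ z ∈ NZBC.Dplus q₀ ∪ NZBC.Sig0 q₀, ∃! ψ, NZBC.IsJostColumn q₀ q qm atBot 0 z ψ) ∧
    (∀ z ∈ NZBC.Dminus q₀ ∪ NZBC.Sig0 q₀, ∃! ψ, NZBC.IsJostColumn q₀ q qm atBot 1 z ψ) ∧
    (∀ z ∈ NZBC.Dminus q₀ ∪ NZBC.Sig0 q₀, ∃! ψ, NZBC.IsJostColumn q₀ q qp atTop 0 z ψ) ∧
    (∀ z ∈ NZBC.Dplus q₀ ∪ NZBC.Sig0 q₀, ∃! ψ, NZBC.IsJostColumn q₀ q qp atTop 1 z ψ) ∧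
    -- `ψm1`, `ψm2`, `ψp1`, `ψp2` are these columns, as functions of `z`, `x`, `t`
    ∀ ψm1 ψm2 ψp1 ψp2 : ℂ → ℝ → ℝ → Fin 2 → ℂ,
      (∀ z ∈ NZBC.Dplus q₀ ∪ NZBC.Sig0 q₀, NZBC.IsJostColumn q₀ q qm atBot 0 z (ψm1 z)) →
      (∀ z ∈ NZBC.Dminus q₀ ∪ NZBC.Sig0 q₀, NZBC.IsJostColumn q₀ q qm atBot 1 z (ψm2 z)) →
      (∀ z ∈ NZBC.Dminus q₀ ∪ NZBC.Sig0 q₀, NZBC.IsJostColumn q₀ q qp atTop 0 z (ψp1 z)) →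
      (∀ z ∈ NZBC.Dplus q₀ ∪ NZBC.Sig0 q₀, NZBC.IsJostColumn q₀ q qp atTop 1 z (ψp2 z)) →
      (∀ z ∈ NZBC.Dplus q₀ ∪ NZBC.Dminus q₀ ∪ NZBC.Sig0 q₀, NZBC.gam q₀ z ≠ 0) ∧
      (∀ z ∈ NZBC.Sig0 q₀, ∀ x t,
        (NZBC.ofCols (ψm1 z x t) (ψm2 z x t)).det = NZBC.gam q₀ z ∧
        (NZBC.ofCols (ψp1 z x t) (ψp2 z x t)).det = NZBC.gam q₀ z) ∧
      -- off `Σ₀`, only the entry `S z 0 0` (on `D⁻`) and the entry `S z 1 1` (on `D⁺`) are meant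
      ∃ S : ℂ → Matrix (Fin 2) (Fin 2) ℂ,
        (∀ z ∈ NZBC.Sig0 q₀,
          (∀ x t, NZBC.ofCols (ψp1 z x t) (ψp2 z x t)
            = NZBC.ofCols (ψm1 z x t) (ψm2 z x t) * S z) ∧
          (∀ S' : Matrix (Fin 2) (Fin 2) ℂ,
            (∀ x t, NZBC.ofCols (ψp1 z x t) (ψp2 z x t)
              = NZBC.ofCols (ψm1 z x t) (ψm2 z x t) * S') → S' = S z) ∧
          (S z).det = 1) ∧
        (∀ z ∈ NZBC.Dminus q₀ ∪ NZBC.Sig0 q₀, ∀ x t,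
          S z 0 0 = NZBC.Wr (ψp1 z x t) (ψm2 z x t) / NZBC.gam q₀ z) ∧
        (∀ z ∈ NZBC.Dplus q₀ ∪ NZBC.Sig0 q₀, ∀ x t,
          S z 1 1 = NZBC.Wr (ψm1 z x t) (ψp2 z x t) / NZBC.gam q₀ z) ∧
        (∀ z ∈ NZBC.Sig0 q₀, ∀ x t,
          S z 0 1 = NZBC.Wr (ψp2 z x t) (ψm2 z x t) / NZBC.gam q₀ z ∧
          S z 1 0 = NZBC.Wr (ψm1 z x t) (ψp1 z x t) / NZBC.gam q₀ z) ∧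
        AnalyticOnNhd ℂ (fun z => S z 0 0) (NZBC.Dminus q₀) ∧
        ContinuousOn (fun z => S z 0 0) (NZBC.Dminus q₀ ∪ NZBC.Sig0 q₀) ∧
        AnalyticOnNhd ℂ (fun z => S z 1 1) (NZBC.Dplus q₀) ∧
        ContinuousOn (fun z => S z 1 1) (NZBC.Dplus q₀ ∪ NZBC.Sig0 q₀) ∧
        ContinuousOn (fun z => S z 0 1) (NZBC.Sig0 q₀) ∧
        ContinuousOn (fun z => S z 1 0) (NZBC.Sig0 q₀) := by
  have hIm : ∀ t, IntegrableOn (fun y => q (1 * y) t - qm) (Set.Iic 0) := by simpa using hLm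
  -- the end `x → ∞` is treated as `y → -∞` with `x = -y`
  have hIp : ∀ t, IntegrableOn (fun y => q (-1 * y) t - qp) (Set.Iic 0) := fun t => by
    have h : IntegrableOn (fun x => q x t - qp) (Set.Ici (-0)) := by simpa using hLp t
    simpa using h.comp_neg_Iic
  have hm := NZBC.jostColumn_existsUnique_and_regular hq hqm hbm (ε := 1) (by simp)
    (by simpa using! tendsto_id) (by simpa using! tendsto_id) hIm
  have hp := NZBC.jostColumn_existsUnique_and_regular hq hqp hbp (ε := -1) (by simp)
    (by simpa using tendsto_neg_atTop_atBot) (by simpa using tendsto_neg_atBot_atTop) hIp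
  -- the functions `g` are the values of the four columns at the origin
  obtain ⟨em1, gm1, cm1, dm1, vm1⟩ := hm 0
  obtain ⟨em2, gm2, cm2, dm2, vm2⟩ := hm 1
  obtain ⟨ep1, gp1, cp1, dp1, vp1⟩ := hp 0
  obtain ⟨ep2, gp2, cp2, dp2, vp2⟩ := hp 1
  have hplus := NZBC.jostDom_one hq₀
  have hminus := NZBC.jostDom_neg_one hq₀
  simp only [NZBC.sg_zero, NZBC.sg_one, mul_one, one_mul, neg_mul, neg_neg, hplus, hminus]
    at em1 cm1 dm1 vm1 em2 cm2 dm2 vm2 ep1 cp1 dp1 vp1 ep2 cp2 dp2 vp2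
  refine ⟨em1, em2, ep1, ep2, fun ψm1 ψm2 ψp1 ψp2 hm1 hm2 hp1 hp2 => ?_⟩
  have hP : ∀ z ∈ NZBC.Dplus q₀ ∪ NZBC.Sig0 q₀, z ≠ 0 ∧ NZBC.gam q₀ z ≠ 0 := fun z hz => by
    rw [← hplus] at hz
    exact ⟨hz.1, hz.2.1⟩
  have hM : ∀ z ∈ NZBC.Dminus q₀ ∪ NZBC.Sig0 q₀, z ≠ 0 ∧ NZBC.gam q₀ z ≠ 0 := fun z hz => by
    rw [← hminus] at hz
    exact ⟨hz.1, hz.2.1⟩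
  have hWm : ∀ z ∈ NZBC.Sig0 q₀, ∀ x t, NZBC.Wr (ψm1 z x t) (ψm2 z x t) = NZBC.gam q₀ z :=
    fun z hz => (hm1 z (Or.inr hz)).Wr_eq_gam hqm (hm2 z (Or.inr hz))
  have hWp : ∀ z ∈ NZBC.Sig0 q₀, ∀ x t, NZBC.Wr (ψp1 z x t) (ψp2 z x t) = NZBC.gam q₀ z :=
    fun z hz => (hp1 z (Or.inr hz)).Wr_eq_gam hqp (hp2 z (Or.inr hz))
  have hγ : ∀ z ∈ NZBC.Sig0 q₀, NZBC.gam q₀ z ≠ 0 := fun z hz => (hP z (Or.inr hz)).2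
  refine ⟨?_, fun z hz x t => ⟨hWm z hz x t, hWp z hz x t⟩,
    fun z => NZBC.scatMatrix (NZBC.gam q₀ z) (ψm1 z 0 0) (ψm2 z 0 0) (ψp1 z 0 0) (ψp2 z 0 0),
    fun z hz => ?_, fun z hz x t => ?_, fun z hz x t => ?_, fun z hz x t => ⟨?_, ?_⟩,
    ?_, ?_, ?_, ?_, ?_, ?_⟩
  · rintro z ((hz | hz) | hz)
    exacts [(hP z (Or.inl hz)).2, (hM z (Or.inl hz)).2, hγ z hz]
  · have hS : ∀ x t, NZBC.ofCols (ψp1 z x t) (ψp2 z x t)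
        = NZBC.ofCols (ψm1 z x t) (ψm2 z x t) *
          NZBC.scatMatrix (NZBC.gam q₀ z) (ψm1 z 0 0) (ψm2 z 0 0) (ψp1 z 0 0) (ψp2 z 0 0) := by
      intro x t
      rw [NZBC.ofCols_eq_mul _ _ (ψp1 z x t) (ψp2 z x t) (hγ z hz) (hWm z hz x t),
        NZBC.scatMatrix, NZBC.scatMatrix,
        (hp1 z (Or.inr hz)).Wr_const (hm2 z (Or.inr hz)) x t 0 0,
        (hp2 z (Or.inr hz)).Wr_const (hm2 z (Or.inr hz)) x t 0 0,
        (hm1 z (Or.inr hz)).Wr_const (hp1 z (Or.inr hz)) x t 0 0,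
        (hm1 z (Or.inr hz)).Wr_const (hp2 z (Or.inr hz)) x t 0 0]
    have hdet : (NZBC.ofCols (ψm1 z 0 0) (ψm2 z 0 0)).det = NZBC.gam q₀ z := hWm z hz 0 0
    refine ⟨hS, fun S' hS' => ?_, ?_⟩
    · have hu : IsUnit (NZBC.ofCols (ψm1 z 0 0) (ψm2 z 0 0)).det := by
        rw [hdet]
        exact (hγ z hz).isUnit
      have h := congrArg (fun A => (NZBC.ofCols (ψm1 z 0 0) (ψm2 z 0 0))⁻¹ * A)
        ((hS' 0 0).symm.trans (hS 0 0))
      simpa only [Matrix.nonsing_inv_mul_cancel_left _ _ hu] using h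
    · have h := congrArg Matrix.det (hS 0 0)
      rw [Matrix.det_mul, hdet] at h
      have hdet' : (NZBC.ofCols (ψp1 z 0 0) (ψp2 z 0 0)).det = NZBC.gam q₀ z := hWp z hz 0 0
      rw [hdet'] at h
      exact mul_left_cancel₀ (hγ z hz) (h.symm.trans (mul_one _).symm)
  · rw [(hp1 z hz).Wr_const (hm2 z hz) x t 0 0]
    rfl
  · rw [(hm1 z hz).Wr_const (hp2 z hz) x t 0 0]
    rfl
  · rw [(hp2 z (Or.inr hz)).Wr_const (hm2 z (Or.inr hz)) x t 0 0]
    rfl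
  · rw [(hm1 z (Or.inr hz)).Wr_const (hp1 z (Or.inr hz)) x t 0 0]
    rfl
  · refine DifferentiableOn.analyticOnNhd ?_ (NZBC.isOpen_Dminus q₀)
    refine (NZBC.differentiableOn_Wr_div (fun z hz => hM z (Or.inl hz))
      (dp1 _ (NZBC.isOpen_Dminus q₀) Set.subset_union_left)
      (dm2 _ (NZBC.isOpen_Dminus q₀) Set.subset_union_left)).congr fun z hz => ?_
    exact congrArg₂ (fun v w => NZBC.Wr v w / NZBC.gam q₀ z)
      (vp1 z (Or.inl hz) _ (hp1 z (Or.inl hz)))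
      (vm2 z (Or.inl hz) _ (hm2 z (Or.inl hz)))
  · refine (NZBC.continuousOn_Wr_div hM cp1 cm2).congr fun z hz => ?_
    exact congrArg₂ (fun v w => NZBC.Wr v w / NZBC.gam q₀ z)
      (vp1 z hz _ (hp1 z hz))
      (vm2 z hz _ (hm2 z hz))
  · refine DifferentiableOn.analyticOnNhd ?_ (NZBC.isOpen_Dplus q₀)
    refine (NZBC.differentiableOn_Wr_div (fun z hz => hP z (Or.inl hz))
      (dm1 _ (NZBC.isOpen_Dplus q₀) Set.subset_union_left)
      (dp2 _ (NZBC.isOpen_Dplus q₀) Set.subset_union_left)).congr fun z hz => ?_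
    exact congrArg₂ (fun v w => NZBC.Wr v w / NZBC.gam q₀ z)
      (vm1 z (Or.inl hz) _ (hm1 z (Or.inl hz)))
      (vp2 z (Or.inl hz) _ (hp2 z (Or.inl hz)))
  · refine (NZBC.continuousOn_Wr_div hP cm1 cp2).congr fun z hz => ?_
    exact congrArg₂ (fun v w => NZBC.Wr v w / NZBC.gam q₀ z)
      (vm1 z hz _ (hm1 z hz))
      (vp2 z hz _ (hp2 z hz))
  · refine (NZBC.continuousOn_Wr_div (fun z hz => hP z (Or.inr hz))
      (cp2.mono Set.subset_union_right) (cm2.mono Set.subset_union_right)).congr fun z hz => ?_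
    exact congrArg₂ (fun v w => NZBC.Wr v w / NZBC.gam q₀ z)
      (vp2 z (Or.inr hz) _ (hp2 z (Or.inr hz)))
      (vm2 z (Or.inr hz) _ (hm2 z (Or.inr hz)))
  · refine (NZBC.continuousOn_Wr_div (fun z hz => hP z (Or.inr hz))
      (cm1.mono Set.subset_union_right) (cp1.mono Set.subset_union_right)).congr fun z hz => ?_
    exact congrArg₂ (fun v w => NZBC.Wr v w / NZBC.gam q₀ z)
      (vm1 z (Or.inr hz) _ (hm1 z (Or.inr hz)))
      (vp1 z (Or.inr hz) _ (hp1 z (Or.inr hz)))
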